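/- Let $G$ be a finite group. A continuous map $f\colon X\to Y$ of (left) $G$-spaces is \emph{isovariant} if $f(gx)=gf(x)$ and $G_{f(x)}=G_x$ for all $g\in G$, $x\in X$, where $G_x$ is the isotropy group of $x$. Let $\mathsf{isvt\text{-}Top}$ be the category of $G$-spaces and isovariant maps, let $\mathsf{Map_{isvt}}(X,Y)$ be the set of isovariant maps with the subspace topology of the compact-open topology, and let $\mathsf{isvt\text{-}Top}_+$ be the category obtained from $\mathsf{isvt\text{-}Top}$ by adjoining a formal terminal object $\ast$ (with no morphisms from $\ast$ to a $G$-space), with $\mathsf{Map_{isvt}}(X,\ast)$ a one-point space. For a strictly increasing chain of subgroups $\mathbf H=(H_0<\dots<H_m)$ of $G$, $m\ge 0$ (that is, an object of the link orbit category $\mathcal L_G$), let $\Delta^{\mathbf H}_G=(G\times\Delta^m)/\!\sim$, where $(g,x)\sim(g',x)$ if for some $0\le k\le m$ one has $x=(t_0,\dots,t_{m-k},0,\dots,0)$ and $gH_k=g'H_k$, with $G$-action $g'\cdot[g,x]=[g'g,x]$. For a space $A$, $G$ acts on $\Delta^{\mathbf H}_G\times A$ through the first factor. Then for every chain $\mathbf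 H$ the functor $\Delta^{\mathbf H}_G\times-\colon\mathsf{Top}\to\mathsf{isvt\text{-}Top}_+$ is left adjoint to $\mathsf{Map_{isvt}}(\Delta^{\mathbf H}_G,-)$, and $\mathsf{isvt\text{-}Top}_+$ is a cofibrantly generated model category (with all small limits and colimits and with functorial factorizations) in which: (1) the set of generating cofibrations is $\{\Delta^{\mathbf H}_G\times S^{n-1}\to\Delta^{\mathbf H}_G\times D^n\}$ and the set of generating acyclic cofibrations is $\{\Delta^{\mathbf H}_G\times D^n\times\{0\}\to\Delta^{\mathbf H}_G\times D^n\times[0,1]\}$, where $\mathbf H$ runs over all chains and $n\ge 0$. That is, the domains of these maps are small relative to the respective relative cell complexes, the acyclic fibrations are the maps with the right lifting property against the first set, and the fibrations are those with the right lifting property against the second; (2) a map $f$ is a weak equivalence (resp. a fibration) if and only if $\mathsf{Map_{isvt}}(\Delta^{\mathbf H}_G,f)$ is a weak homotopy equivalence (resp. a Serre fibration) of spaces for every chain $\mathbf H$. -/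

import Mathlib

universe v u

open CategoryTheory Limits HomotopicalAlgebra

section WeakEquivalencesOfSpaces

open scoped Topology Topology.Homotopy unitInterval

/-- The map induced by `f` on path components. -/
def zerothHomotopyMap {X Y : Type u} [TopologicalSpace X] [TopologicalSpace Y] (f : C(X, Y)) :
    ZerothHomotopy X → ZerothHomotopy Y :=
  Quotient.map f (fun _ _ h ↦ h.map (map_continuous f))

/-- The map induced by `f` on the homotopy groups `π_n(-, x)`. -/
def homotopyGroupMap {X Y : Type u} [TopologicalSpace X] [TopologicalSpace Y] (f : C(X, Y))
    (n : ℕ) (x : X) : π_ n X x → π_ n Y (f x) :=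
  Quotient.map
    (fun γ : GenLoop (Fin n) X x ↦
      (⟨f.comp γ.1, fun y hy ↦ congrArg f (γ.2 y hy)⟩ : GenLoop (Fin n) Y (f x)))
    (fun _ _ h ↦ ContinuousMap.HomotopicRel.comp_continuousMap h f)

/-- Weak homotopy equivalences of topological spaces: maps inducing a bijection on path components
and on all homotopy groups, at all base points. -/
def weakHomotopyEquivalences : MorphismProperty TopCat.{u} := fun X _ f ↦
  Function.Bijective (zerothHomotopyMap f.hom) ∧
    ∀ (n : ℕ) (x : X), Function.Bijective (homotopyGroupMap f.hom (n + 1) x)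

/-- The inclusion `D^n × {0} ⟶ D^n × [0,1]`. -/
noncomputable def diskCylinderInclusion (n : ℕ) :
    TopCat.of (TopCat.disk.{u} n × ({0} : Set I)) ⟶ TopCat.of (TopCat.disk.{u} n × I) :=
  TopCat.ofHom ⟨fun p ↦ (p.1, p.2.1), by fun_prop⟩

/-- Serre fibrations: the maps with the right lifting property with respect to all the inclusions
`D^n × {0} ⟶ D^n × [0,1]`. -/
def serreFibrations : MorphismProperty TopCat.{u} :=
  (MorphismProperty.ofHoms (fun n : ℕ ↦ diskCylinderInclusion.{u} n)).rlp

end WeakEquivalencesOfSpaces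

/-- A `G`-space, for a (discrete) group `G`: a topological space with a continuous left action. -/
structure IsvtTop (G : Type u) [Group G] : Type (u + 1) where
  carrier : Type u
  [top : TopologicalSpace carrier]
  [act : MulAction G carrier]
  [cont : ContinuousConstSMul G carrier]

namespace IsvtTop

attribute [instance] top act cont

variable {G : Type u} [Group G]

/-- A continuous map of `G`-spaces is isovariant if it is equivariant and preserves isotropy
groups. -/
def IsIsovariant {X Y : IsvtTop G} (f : C(X.carrier, Y.carrier)) : Prop :=
  (∀ (g : G) (x : X.carrier), f (g • x) = g • f x) ∧
    ∀ x : X.carrier, MulAction.stabilizer G (f x) = MulAction.stabilizer G x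

/-- The category of `G`-spaces and isovariant maps. -/
instance : Category.{u} (IsvtTop G) where
  Hom X Y := {f : C(X.carrier, Y.carrier) // IsIsovariant f}
  id X := ⟨ContinuousMap.id _, fun _ _ ↦ rfl, fun _ ↦ rfl⟩
  comp f g := ⟨g.1.comp f.1, fun a x ↦ by simp [f.2.1, g.2.1],
    fun x ↦ (g.2.2 (f.1 x)).trans (f.2.2 x)⟩

/-- The functor `Map_isvt(X, -)`: the set of isovariant maps `X → Y` is topologized as a subspace
of the space of continuous maps with the compact-open topology. -/
def mapIsvt (X : IsvtTop G) : IsvtTop G ⥤ TopCat.{u} where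
  obj Y := TopCat.of {f : C(X.carrier, Y.carrier) // IsIsovariant f}
  map {Y Z} φ := TopCat.ofHom
    { toFun := fun f ↦ ⟨φ.1.comp f.1, fun a x ↦ by simp [f.2.1, φ.2.1],
        fun x ↦ (φ.2.2 (f.1 x)).trans (f.2.2 x)⟩
      continuous_toFun :=
        ((ContinuousMap.continuous_postcomp φ.1).comp continuous_subtype_val).subtype_mk _ }

/-- The `G`-space `X × A`, where `G` acts on the factor `X` only. -/
def prodTop (X : IsvtTop G) (A : TopCat.{u}) : IsvtTop G :=
  letI : MulAction G (X.carrier × A) :=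
    { smul := fun g p ↦ (g • p.1, p.2)
      one_smul := fun p ↦ Prod.ext (one_smul G p.1) rfl
      mul_smul := fun g h p ↦ Prod.ext (mul_smul g h p.1) rfl }
  haveI : ContinuousConstSMul G (X.carrier × A) :=
    ⟨fun g ↦ Continuous.prodMk ((continuous_const_smul g).comp continuous_fst) continuous_snd⟩
  { carrier := X.carrier × A }

/-- The functor `X × -` from spaces to `G`-spaces and isovariant maps. -/
def prodFunctor (X : IsvtTop G) : TopCat.{u} ⥤ IsvtTop G where
  obj A := X.prodTop A
  map {A B} f := ⟨⟨fun p : X.carrier × A ↦ ((p.1, f p.2) : X.carrier × B),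
      continuous_fst.prodMk ((map_continuous f.hom).comp continuous_snd)⟩,
    fun _ _ ↦ rfl, fun p ↦ by
      ext g
      exact ⟨fun h ↦ Prod.ext (congrArg Prod.fst h :) rfl,
        fun h ↦ Prod.ext (congrArg Prod.fst h :) rfl⟩⟩

section LinkingSimplex

/-- For a chain `H_0 < ⋯ < H_n` of subgroups of `G`, the equivalence relation on `G × Δ^n` with
`(g, x) ∼ (g', x)` if, for some `0 ≤ k ≤ n`, `x = (t_0, …, t_{n-k}, 0, …, 0)` and
`g H_k = g' H_k`. -/
def linkSetoid (H : LTSeries (Subgroup G)) : Setoid (G × stdSimplex ℝ (Fin (H.length + 1))) where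
  r p q := p.2 = q.2 ∧ ∃ k : Fin (H.length + 1),
    (∀ i : Fin (H.length + 1), H.length < (i : ℕ) + k → p.2.1 i = 0) ∧
      (p.1 : G ⧸ H k) = (q.1 : G ⧸ H k)
  iseqv :=
    { refl := fun p ↦ ⟨rfl, 0, fun i hi ↦ absurd i.2 (by simp at hi; omega), rfl⟩
      symm := by
        rintro ⟨g, x⟩ ⟨g', x'⟩ ⟨rfl, k, hk, h⟩
        exact ⟨rfl, k, hk, h.symm⟩
      trans := by
        rintro ⟨g, x⟩ ⟨g', x'⟩ ⟨g'', x''⟩ ⟨rfl, k, hk, h⟩ ⟨rfl, l, hl, h'⟩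
        refine ⟨rfl, ?_⟩
        simp only [QuotientGroup.eq] at h h' ⊢
        rcases le_total k l with hkl | hkl
        · exact ⟨l, hl, by simpa [mul_assoc] using mul_mem (H.monotone hkl h) h'⟩
        · exact ⟨k, hk, by simpa [mul_assoc] using mul_mem h (H.monotone hkl h')⟩ }

/-- The underlying space of the linking simplex: the quotient of `G × Δ^n`, `G` being discrete. -/
def LinkingSimplex (H : LTSeries (Subgroup G)) : Type u :=
  Quotient (linkSetoid H)

instance (H : LTSeries (Subgroup G)) : TopologicalSpace (LinkingSimplex H) :=
  letI : TopologicalSpace G := ⊥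
  inferInstanceAs (TopologicalSpace (Quotient (linkSetoid H)))

/-- The left action `g' • [g, x] = [g' g, x]`. -/
instance (H : LTSeries (Subgroup G)) : MulAction G (LinkingSimplex H) where
  smul a := Quotient.map (fun p ↦ (a * p.1, p.2)) (by
    rintro ⟨g, x⟩ ⟨g', x'⟩ ⟨h, k, hk, h'⟩
    refine ⟨h, k, hk, ?_⟩
    simp only [QuotientGroup.eq] at h' ⊢
    simpa [mul_assoc] using h')
  one_smul := by
    rintro ⟨g, x⟩
    exact congrArg (Quotient.mk (linkSetoid H)) (Prod.ext (one_mul g) rfl)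
  mul_smul := by
    rintro a b ⟨g, x⟩
    exact congrArg (Quotient.mk (linkSetoid H)) (Prod.ext (mul_assoc a b g) rfl)

instance (H : LTSeries (Subgroup G)) : ContinuousConstSMul G (LinkingSimplex H) where
  continuous_const_smul a := by
    let _ : TopologicalSpace G := ⊥
    have : DiscreteTopology G := ⟨rfl⟩
    refine continuous_quot_lift _ (continuous_quot_mk.comp ?_)
    exact ((continuous_of_discreteTopology (f := fun g : G ↦ a * g)).comp continuous_fst).prodMk
      continuous_snd

/-- The linking simplex `Δ^H_G` as a `G`-space. -/
def linkingSimplex (H : LTSeries (Subgroup G)) : IsvtTop G where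
  carrier := LinkingSimplex H

end LinkingSimplex

variable (G) in
/-- The category of `G`-spaces and isovariant maps, completed by a formal terminal object. -/
abbrev Completed : Type (u + 1) :=
  WithTerminal (IsvtTop G)

/-- The functor `Δ^H_G × -` from spaces to the completed category. -/
def linkProd (H : LTSeries (Subgroup G)) : TopCat.{u} ⥤ Completed G :=
  (linkingSimplex H).prodFunctor ⋙ WithTerminal.incl

/-- The functor `Map_isvt(Δ^H_G, -)` on the completed category; it sends the formal terminal object
to the one-point space. -/
def linkMap (H : LTSeries (Subgroup G)) : Completed G ⥤ TopCat.{u} :=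
  WithTerminal.liftToTerminal (linkingSimplex H).mapIsvt TopCat.isTerminalPUnit

variable (G) in
/-- The maps `Δ^H_G × S^{n-1} ⟶ Δ^H_G × D^n`, for all chains `H` of subgroups of `G` and all
`n`. -/
def generatingCofibrations : MorphismProperty (Completed G) :=
  MorphismProperty.ofHoms (fun p : LTSeries (Subgroup G) × ℕ ↦
    (linkProd p.1).map (TopCat.diskBoundaryInclusion.{u} p.2))

variable (G) in
/-- The maps `Δ^H_G × D^n × {0} ⟶ Δ^H_G × D^n × [0,1]`, for all chains `H` of subgroups of `G` and
all `n`. -/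
def generatingAcyclicCofibrations : MorphismProperty (Completed G) :=
  MorphismProperty.ofHoms (fun p : LTSeries (Subgroup G) × ℕ ↦
    (linkProd p.1).map (diskCylinderInclusion.{u} p.2))

end IsvtTop

section CofibrantlyGenerated

variable {C : Type v} [Category.{u} C]

/-- `A` is small relative to a class `D` of morphisms if, for some regular cardinal `κ`,
`Hom(A, -)` commutes with the colimits of all sequences of morphisms of `D` indexed by a
`κ`-filtered limit ordinal. -/
def IsSmallRelativeTo (A : C) (D : MorphismProperty C) : Prop :=
  ∃ (κ : Cardinal.{u}) (_ : Fact κ.IsRegular),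
    ∀ (J : Type u) [LinearOrder J] [SuccOrder J] [OrderBot J] [WellFoundedLT J] [NoMaxOrder J]
      [IsCardinalFiltered J κ] (F : J ⥤ C) [F.IsWellOrderContinuous],
      (∀ j : J, D (F.map (homOfLE (Order.le_succ j)))) →
        PreservesColimit F (coyoneda.obj (Opposite.op A))

/-- The relative `I`-cell complexes: transfinite compositions of pushouts of elements of `I`. -/
def relativeCells (I : MorphismProperty C) : MorphismProperty C :=
  MorphismProperty.transfiniteCompositions.{u} I.pushouts

/-- A model structure (with `u`-small limits and colimits and functorial factorizations) is
cofibrantly generated, with generating cofibrations `I` and generating acyclic cofibrations `J`, if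
`I` and `J` are sets of morphisms, the domains of `I` (resp. `J`) are small relative to the relative
`I`-cell (resp. `J`-cell) complexes, the trivial fibrations are the maps with the right lifting
property with respect to `I`, and the fibrations are those with the right lifting property with
respect to `J`. -/
structure IsCofibrantlyGeneratedBy [ModelCategory C] (I J : MorphismProperty C) : Prop where
  hasLimits : HasLimits C
  hasColimits : HasColimits C
  factorization_cof : (cofibrations C).HasFunctorialFactorization (trivialFibrations C)
  factorization_fib : (trivialCofibrations C).HasFunctorialFactorization (fibrations C)
  isSmall_I : MorphismProperty.IsSmall.{u} I
  isSmall_J : MorphismProperty.IsSmall.{u} J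
  domains_I {A B : C} (i : A ⟶ B) (hi : I i) : IsSmallRelativeTo A (relativeCells I)
  domains_J {A B : C} (j : A ⟶ B) (hj : J j) : IsSmallRelativeTo A (relativeCells J)
  trivialFibrations_eq : trivialFibrations C = I.rlp
  fibrations_eq : fibrations C = J.rlp

end CofibrantlyGenerated

/-! With `I` and `J` the two generating sets, the model structure is an instance of the
recognition theorem: a map is in `I.rlp` if and only if it is a weak equivalence in `J.rlp`, and
every map of `J.rlp.llp` is a weak equivalence.

By adjunction, `f` has the right lifting property against `Δ^H_G × i` if and only if
`Map_isvt(Δ^H_G, f)` has it against `i`, so the first condition reduces to the same statement for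
spaces: a Serre fibration is a weak homotopy equivalence if and only if it has the right lifting
property against the inclusions `S^{n-1} ⟶ D^n`. For the second one, every object is fibrant, so a
map `i : A ⟶ B` of `J.rlp.llp` has a retraction `r`. The paths in `B` along which the isotropy group
is constant form a path object, whose endpoint map to `B × B` is in `J.rlp`. Lifting `i` against it
yields a homotopy from the identity to `r ≫ i` through isovariant maps, relative to `A`, so that
`Map_isvt(Δ^H_G, i)` is the inclusion of a deformation retract.

The small object argument applies because the maps `Δ^H_G × i`, for `i` an embedding, and all maps
obtained from them by pushouts and transfinite compositions, are embeddings: being an embedding is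
a left lifting property, against the maps in `embeddingTests`. -/

/-! ### Relative lifting problems -/

section RelativeLifting

open Set Topology unitInterval

variable {P P' X Y : Type*} [TopologicalSpace P] [TopologicalSpace P'] [TopologicalSpace X]
  [TopologicalSpace Y] {f : C(X, Y)} {S T : Set P}

/-- The relative lifting property of `f` with respect to a pair `(P, S)`: a map `P → Y` whose
restriction to `S` is lifted along `f` admits a lift extending the given one. The partial lift `a`
is encoded as a function on `P`, of which only the values on `S` matter. -/
def LiftsPair (S : Set P) (f : C(X, Y)) : Prop :=
  ∀ (b : C(P, Y)) (a : P → X), ContinuousOn a S → (∀ p ∈ S, f (a p) = b p) →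
    ∃ c : C(P, X), (∀ p, f (c p) = b p) ∧ EqOn c a S

lemma LiftsPair.of_retract {S' : Set P'} (h : LiftsPair S' f) (i : C(P, P'))
    (r : C(P', P)) (hri : ∀ p, r (i p) = p) (hi : MapsTo i S S') (hr : MapsTo r S' S) :
    LiftsPair S f := by
  intro b a ha hab
  obtain ⟨c, hc, hc'⟩ := h (b.comp r) (a ∘ r) (ha.comp r.continuous.continuousOn hr)
    (fun p hp ↦ hab _ (hr hp))
  refine ⟨c.comp i, fun p ↦ by simp [hc, hri], fun p hp ↦ ?_⟩
  simp [hc' (hi hp), hri]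

lemma LiftsPair.preimage_homeomorph {S' : Set P'} (h : LiftsPair S' f) (e : P ≃ₜ P') :
    LiftsPair (e ⁻¹' S') f :=
  h.of_retract (e : C(P, P')) (e.symm : C(P', P)) (by simp) (fun _ hp ↦ hp)
    (fun p hp ↦ by simpa using hp)

/-- A subset `S` of `P` is a retract if the identity of `S` extends to a continuous map `P → S`,
here viewed as a map from `P` to itself. -/
def IsRetract (S : Set P) : Prop :=
  ∃ r : C(P, P), (∀ p, r p ∈ S) ∧ ∀ p ∈ S, r p = p

lemma IsRetract.exists_extension (h : IsRetract S) {a : P → X} (ha : ContinuousOn a S) :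
    ∃ c : C(P, X), EqOn c a S := by
  obtain ⟨r, hr, hr'⟩ := h
  exact ⟨⟨a ∘ r, ha.comp_continuous r.continuous hr⟩, fun p hp ↦ congrArg a (hr' p hp)⟩

lemma IsRetract.preimage_homeomorph {S' : Set P'} (h : IsRetract S') (e : P ≃ₜ P') :
    IsRetract (e ⁻¹' S') := by
  obtain ⟨r, hr, hr'⟩ := h
  exact ⟨(e.symm : C(P', P)).comp (r.comp (e : C(P, P'))), fun p ↦ by simpa using hr (e p),
    fun p hp ↦ by simp [hr' (e p) hp]⟩

variable (P) in
/-- The bottom `P × {0}` of the cylinder `P × I`. -/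
def cylinderBase : Set (P × I) := {p | p.2 = 0}

/-- The part `P × {0} ∪ T × I` of the cylinder `P × I`. -/
def cylinderBox (T : Set P) : Set (P × I) := {p | p.2 = 0 ∨ p.1 ∈ T}

/-- The part `P × {0, 1} ∪ T × I` of the cylinder `P × I`. -/
def cylinderBoundary (T : Set P) : Set (P × I) := {p | p.2 = 0 ∨ p.2 = 1 ∨ p.1 ∈ T}

lemma cylinderBox_subset_cylinderBoundary {P : Type*} {T : Set P} :
    cylinderBox T ⊆ cylinderBoundary T :=
  fun _ hp ↦ hp.imp_right Or.inr

lemma isClosed_cylinderBox (hT : IsClosed T) : IsClosed (cylinderBox T) :=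
  (isClosed_eq continuous_snd continuous_const).union (hT.preimage continuous_fst)

lemma cylinderBoundary_eq_union {P : Type*} {T : Set P} :
    cylinderBoundary T = cylinderBox T ∪ {p | p.2 = 1} := by
  ext p
  simp only [cylinderBoundary, cylinderBox, mem_union, mem_ofPred_eq]
  tauto

section Glue

lemma exists_glue {S₁ S₂ : Set P} (h₁ : IsClosed S₁) (h₂ : IsClosed S₂) {a₁ a₂ : P → X}
    (ha₁ : ContinuousOn a₁ S₁) (ha₂ : ContinuousOn a₂ S₂) (h : ∀ p ∈ S₁, p ∈ S₂ → a₁ p = a₂ p) :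
    ∃ a : P → X, EqOn a a₁ S₁ ∧ EqOn a a₂ S₂ ∧ ContinuousOn a (S₁ ∪ S₂) := by
  classical
  have e₁ : EqOn (S₁.piecewise a₁ a₂) a₁ S₁ := piecewise_eqOn _ _ _
  have e₂ : EqOn (S₁.piecewise a₁ a₂) a₂ S₂ := fun p hp ↦ by
    by_cases h' : p ∈ S₁
    · rw [e₁ h', h p h' hp]
    · exact piecewise_eq_of_notMem _ _ _ h'
  exact ⟨_, e₁, e₂, (ha₁.congr e₁).union_of_isClosed (ha₂.congr e₂) h₁ h₂⟩

lemma exists_glue_box (hT : IsClosed T) (g : C(P, X)) {s : P × I → X}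
    (hs : ContinuousOn s {p | p.1 ∈ T}) (h : ∀ p ∈ T, g p = s (p, 0)) :
    ∃ a : P × I → X, (∀ p, a (p, 0) = g p) ∧ (∀ p ∈ T, ∀ t, a (p, t) = s (p, t)) ∧
      ContinuousOn a (cylinderBox T) := by
  obtain ⟨a, h₁, h₂, h₃⟩ := exists_glue (S₁ := cylinderBase P)
    (isClosed_eq continuous_snd continuous_const) (hT.preimage continuous_fst)
    (g.continuous.comp continuous_fst).continuousOn hs (by rintro ⟨p, t⟩ rfl hp; exact h p hp)
  exact ⟨a, fun p ↦ h₁ (show (p, (0 : I)).2 = 0 from rfl), fun p hp t ↦ h₂ (x := (p, t)) hp, h₃⟩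

lemma exists_glue_lid (hT : IsClosed T) {a : P × I → X} (ha : ContinuousOn a (cylinderBox T))
    (g : C(P, X)) (h : ∀ p ∈ T, a (p, 1) = g p) :
    ∃ a' : P × I → X, EqOn a' a (cylinderBox T) ∧ (∀ p, a' (p, 1) = g p) ∧
      ContinuousOn a' (cylinderBoundary T) := by
  obtain ⟨a', h₁, h₂, h₃⟩ := exists_glue (isClosed_cylinderBox hT) (S₂ := {p : P × I | p.2 = 1})
    (isClosed_eq continuous_snd continuous_const) ha
    (g.continuous.comp continuous_fst).continuousOn (by
      rintro ⟨p, t⟩ hp rfl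
      exact h p (hp.resolve_left one_ne_zero))
  exact ⟨a', h₁, fun p ↦ h₂ (show (p, (1 : I)).2 = 1 from rfl), cylinderBoundary_eq_union ▸ h₃⟩

end Glue

lemma LiftsPair.cylinderBox_of_cylinderBoundary (hT : IsClosed T) (h : LiftsPair T f)
    (h' : LiftsPair (cylinderBoundary T) f) : LiftsPair (cylinderBox T) f := by
  intro b a ha hab
  obtain ⟨c, hc, hca⟩ := h (b.comp ((ContinuousMap.id P).prodMk (.const P 1))) (fun p ↦ a (p, 1))
    (ha.comp (by fun_prop) (fun p hp ↦ Or.inr hp)) (fun p hp ↦ hab _ (Or.inr hp))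
  obtain ⟨a', ha', ha'c, ha'_cont⟩ := exists_glue_lid hT ha c (fun p hp ↦ (hca hp).symm)
  obtain ⟨d, hd, hda'⟩ := h' b a' ha'_cont (by
    rw [cylinderBoundary_eq_union]
    rintro ⟨p, t⟩ (hp | rfl)
    · rw [ha' hp, hab _ hp]
    · rw [ha'c]; exact hc p)
  exact ⟨d, hd, (hda'.mono cylinderBox_subset_cylinderBoundary).trans ha'⟩

/-- The homotopy extension property of a closed subset `T` of `P`, in its equivalent formulation by
a retraction of the cylinder. -/
def HasHomotopyExtension (T : Set P) : Prop :=
  IsClosed T ∧ IsRetract (cylinderBox T)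

lemma HasHomotopyExtension.exists_extension (hT : HasHomotopyExtension T) (g : C(P, X))
    {s : P × I → X} (hs : ContinuousOn s {p | p.1 ∈ T}) (h : ∀ p ∈ T, g p = s (p, 0)) :
    ∃ H : C(P × I, X), (∀ p, H (p, 0) = g p) ∧ ∀ p ∈ T, ∀ t, H (p, t) = s (p, t) := by
  obtain ⟨a, h₀, h₁, ha⟩ := exists_glue_box hT.1 g hs h
  obtain ⟨H, hH⟩ := hT.2.exists_extension ha
  exact ⟨H, fun p ↦ by rw [hH (Or.inl rfl), h₀], fun p hp t ↦ by rw [hH (Or.inr hp), h₁ p hp]⟩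

lemma HasHomotopyExtension.preimage_homeomorph {T' : Set P'} (h : HasHomotopyExtension T')
    (e : P ≃ₜ P') : HasHomotopyExtension (e ⁻¹' T') :=
  ⟨h.1.preimage e.continuous, h.2.preimage_homeomorph (e.prodCongr (Homeomorph.refl I))⟩

lemma LiftsPair.exists_lift_of_homotopy (h : LiftsPair (cylinderBox T) f) (hT : IsClosed T)
    (b : C(P × I, Y)) {a : P × I → X} (ha : ContinuousOn a {p | p.1 ∈ T})
    (hab : ∀ p ∈ T, ∀ t, f (a (p, t)) = b (p, t)) (c₀ : C(P, X)) (hc₀ : ∀ p, f (c₀ p) = b (p, 0))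
    (hac₀ : ∀ p ∈ T, c₀ p = a (p, 0)) :
    ∃ c₁ : C(P, X), (∀ p, f (c₁ p) = b (p, 1)) ∧ ∀ p ∈ T, c₁ p = a (p, 1) := by
  obtain ⟨a', h₁, h₂, h₃⟩ := exists_glue_box hT c₀ ha hac₀
  obtain ⟨c, hc, hc'⟩ := h b a' h₃ (by
    rintro ⟨p, t⟩ (rfl | hp)
    · rw [h₁, hc₀]
    · rw [h₂ p hp, hab p hp])
  exact ⟨c.comp ((ContinuousMap.id P).prodMk (.const P 1)), fun p ↦ hc _,
    fun p hp ↦ (hc' (Or.inr hp)).trans (h₂ p hp 1)⟩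

end RelativeLifting

/-! ### Homotopy classes relative to a subset -/

section HomotopyClasses

open Set Topology unitInterval

variable {P P' X Y : Type*} [TopologicalSpace P] [TopologicalSpace P'] [TopologicalSpace X]
  [TopologicalSpace Y] {f : C(X, Y)} {T : Set P}

/-- `HomotopicAlong T p γ₀ γ₁` holds if there is a homotopy from `γ₀` to `γ₁` along which every
point of `T` follows the path `p`. With a constant `p`, this is homotopy relative to `T`. -/
def HomotopicAlong (T : Set P) (p : C(I, X)) (γ₀ γ₁ : C(P, X)) : Prop :=
  ∃ H : C(P × I, X), (∀ q, H (q, 0) = γ₀ q) ∧ (∀ q, H (q, 1) = γ₁ q) ∧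
    ∀ q ∈ T, ∀ t, H (q, t) = p t

namespace HomotopicAlong

variable {p : C(I, X)} {γ₀ γ₁ : C(P, X)}

lemma symm (h : HomotopicAlong T p γ₀ γ₁) :
    HomotopicAlong T (p.comp ⟨unitInterval.symm, continuous_symm⟩) γ₁ γ₀ := by
  obtain ⟨H, h₀, h₁, hT⟩ := h
  exact ⟨H.comp ⟨fun q ↦ (q.1, unitInterval.symm q.2), by fun_prop⟩, by simpa, by simpa,
    fun q hq t ↦ hT q hq _⟩

lemma map (h : HomotopicAlong T p γ₀ γ₁) (f : C(X, Y)) :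
    HomotopicAlong T (f.comp p) (f.comp γ₀) (f.comp γ₁) := by
  obtain ⟨H, h₀, h₁, hT⟩ := h
  exact ⟨f.comp H, by simp [h₀], by simp [h₁], fun q hq t ↦ by simp [hT q hq]⟩

lemma comp_right {T' : Set P'} {γ₀ γ₁ : C(P', X)} (h : HomotopicAlong T' p γ₀ γ₁) (φ : C(P, P'))
    (hφ : MapsTo φ T T') : HomotopicAlong T p (γ₀.comp φ) (γ₁.comp φ) := by
  obtain ⟨H, h₀, h₁, hT'⟩ := h
  exact ⟨H.comp ⟨fun q ↦ (φ q.1, q.2), by fun_prop⟩, by simp [h₀], by simp [h₁],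
    fun q hq t ↦ hT' _ (hφ hq) t⟩

lemma const_iff_homotopicRel {x : X} (h : ∀ q ∈ T, γ₀ q = x) :
    HomotopicAlong T (.const I x) γ₀ γ₁ ↔ γ₀.HomotopicRel γ₁ T := by
  constructor
  · rintro ⟨H, h₀, h₁, hT⟩
    exact ⟨⟨⟨H.comp ⟨Prod.swap, by fun_prop⟩, h₀, h₁⟩,
      fun t q hq ↦ (hT q hq t).trans (h q hq).symm⟩⟩
  · rintro ⟨H⟩
    exact ⟨H.toContinuousMap.comp ⟨Prod.swap, by fun_prop⟩, fun q ↦ H.apply_zero q,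
      fun q ↦ H.apply_one q, fun q hq t ↦ (H.eq_fst t hq).trans (h q hq)⟩

end HomotopicAlong

/-- Surjectivity of the map induced by `f` on homotopy classes, relative to `T`, of the maps from
`P` which send `T` to the base point: for the cube and its boundary, this is surjectivity on the
homotopy group at `x`. -/
def PiSurjective (T : Set P) (f : C(X, Y)) (x : X) : Prop :=
  ∀ γ : C(P, Y), (∀ q ∈ T, γ q = f x) → ∃ γ' : C(P, X), (∀ q ∈ T, γ' q = x) ∧
    HomotopicAlong T (.const I (f x)) (f.comp γ') γ

/-- Injectivity of the map induced by `f` on homotopy classes, relative to `T`, of the maps from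
`P` which send `T` to the base point: for the cube and its boundary, this is injectivity on the
homotopy group at `x`. -/
def PiInjective (T : Set P) (f : C(X, Y)) (x : X) : Prop :=
  ∀ γ₀ γ₁ : C(P, X), (∀ q ∈ T, γ₀ q = x) → (∀ q ∈ T, γ₁ q = x) →
    HomotopicAlong T (.const I (f x)) (f.comp γ₀) (f.comp γ₁) →
      HomotopicAlong T (.const I x) γ₀ γ₁

section Preimage

variable {T' : Set P'} {x : X}

lemma PiSurjective.preimage_homeomorph (h : PiSurjective T' f x) (e : P ≃ₜ P') :
    PiSurjective (e ⁻¹' T') f x := by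
  intro γ hγ
  obtain ⟨γ', hγ', H⟩ := h (γ.comp (e.symm : C(P', P))) (fun q hq ↦ hγ _ (by simpa))
  refine ⟨γ'.comp (e : C(P, P')), fun q hq ↦ hγ' _ hq, ?_⟩
  convert! H.comp_right (e : C(P, P')) (fun p hp ↦ hp)
  ext; simp

lemma PiInjective.preimage_homeomorph (h : PiInjective T' f x) (e : P ≃ₜ P') :
    PiInjective (e ⁻¹' T') f x := by
  intro γ₀ γ₁ hγ₀ hγ₁ H
  have := h (γ₀.comp (e.symm : C(P', P))) (γ₁.comp (e.symm : C(P', P)))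
    (fun q hq ↦ hγ₀ _ (by simpa)) (fun q hq ↦ hγ₁ _ (by simpa))
    (H.comp_right (e.symm : C(P', P)) (fun q hq ↦ by simpa))
  convert! this.comp_right (e : C(P, P')) (fun p hp ↦ hp) <;> ext <;> simp

lemma piSurjective_preimage_homeomorph_iff (e : P ≃ₜ P') :
    PiSurjective (e ⁻¹' T') f x ↔ PiSurjective T' f x :=
  ⟨fun h ↦ by simpa [← preimage_comp] using h.preimage_homeomorph e.symm,
    fun h ↦ h.preimage_homeomorph e⟩

lemma piInjective_preimage_homeomorph_iff (e : P ≃ₜ P') :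
    PiInjective (e ⁻¹' T') f x ↔ PiInjective T' f x :=
  ⟨fun h ↦ by simpa [← preimage_comp] using h.preimage_homeomorph e.symm,
    fun h ↦ h.preimage_homeomorph e⟩

end Preimage

section DeformationRetraction

variable {r : C(Y, X)}

lemma PiInjective.of_retraction (hr : ∀ x, r (f x) = x) (x : X) : PiInjective T f x := by
  intro γ₀ γ₁ _ _ H
  convert! H.map r <;> ext <;> simp [hr]

lemma PiSurjective.of_deformationRetraction (hr : ∀ x, r (f x) = x) {h : C(Y × I, Y)}
    (h0 : ∀ y, h (y, 0) = y) (h1 : ∀ y, h (y, 1) = f (r y)) (hf : ∀ x t, h (f x, t) = f x)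
    (x : X) : PiSurjective T f x := by
  intro γ hγ
  exact ⟨r.comp γ, fun q hq ↦ by simp [hγ q hq, hr],
    h.comp ⟨fun q ↦ (γ q.1, unitInterval.symm q.2), by fun_prop⟩, fun q ↦ by simp [h1],
    fun q ↦ by simp [h0], fun q hq t ↦ by simp [hγ q hq, hf]⟩

end DeformationRetraction

lemma LiftsPair.piSurjective (h : LiftsPair T f) (x : X) : PiSurjective T f x := by
  intro γ hγ
  obtain ⟨c, hc, hc'⟩ := h γ (fun _ ↦ x) continuousOn_const (fun p hp ↦ (hγ p hp).symm)
  exact ⟨c, hc', γ.comp .fst, fun q ↦ (hc q).symm, fun q ↦ rfl, fun q hq _ ↦ hγ q hq⟩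

lemma LiftsPair.piInjective (hT : IsClosed T) (h : LiftsPair (cylinderBoundary T) f) (x : X) :
    PiInjective T f x := by
  rintro γ₀ γ₁ hγ₀ hγ₁ ⟨H, h₀, h₁, h₂⟩
  obtain ⟨a, a₀, aT, ha⟩ := exists_glue_box hT γ₀ (s := fun _ ↦ x) continuousOn_const hγ₀
  obtain ⟨a', a'a, a'₁, ha'⟩ := exists_glue_lid hT ha γ₁
    (fun p hp ↦ (aT p hp 1).trans (hγ₁ p hp).symm)
  have a'₀ (p) : a' (p, 0) = γ₀ p := (a'a (Or.inl rfl)).trans (a₀ p)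
  have a'T (p) (hp : p ∈ T) (t) : a' (p, t) = x := (a'a (Or.inr hp)).trans (aT p hp t)
  obtain ⟨c, -, hc⟩ := h H a' ha' (by
    rintro ⟨p, t⟩ (rfl | rfl | hp)
    · rw [a'₀, h₀]; rfl
    · rw [a'₁, h₁]; rfl
    · rw [a'T p hp, h₂ p hp]; rfl)
  exact ⟨c, fun q ↦ by rw [hc (Or.inl rfl), a'₀], fun q ↦ by rw [hc (Or.inr (Or.inl rfl)), a'₁],
    fun q hq t ↦ hc (Or.inr (Or.inr hq)) |>.trans (a'T q hq t)⟩

section BasePoint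

variable {p : C(I, X)} {γ₀ γ₁ : C(P, X)}

lemma HasHomotopyExtension.exists_homotopicAlong (hT : HasHomotopyExtension T)
    (hγ₀ : ∀ q ∈ T, γ₀ q = p 0) :
    ∃ γ₁ : C(P, X), (∀ q ∈ T, γ₁ q = p 1) ∧ HomotopicAlong T p γ₀ γ₁ := by
  obtain ⟨H, H₀, HT⟩ := hT.exists_extension γ₀ (s := fun q ↦ p q.2) (by fun_prop) hγ₀
  exact ⟨H.comp ((ContinuousMap.id P).prodMk (.const P 1)), fun q hq ↦ HT q hq 1,
    H, H₀, fun q ↦ rfl, HT⟩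

/-- The three given homotopies prescribe a homotopy of the boundary of the cylinder, starting from
the restriction of the third one, and its extension to the whole cylinder ends with the required
homotopy. -/
lemma HomotopicAlong.of_homotopic (hT : IsClosed T)
    (hT' : HasHomotopyExtension (cylinderBoundary T)) {γ₀' γ₁' : C(P, X)}
    (h : HomotopicAlong T p γ₀ γ₁) (h' : HomotopicAlong T p γ₀' γ₁')
    (h₀ : HomotopicAlong T (.const I (p 0)) γ₀ γ₀') :
    HomotopicAlong T (.const I (p 1)) γ₁ γ₁' := by
  obtain ⟨H, H0, H1, HT⟩ := h
  obtain ⟨H', H0', H1', HT'⟩ := h'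
  obtain ⟨G, G0, G1, GT⟩ := h₀
  have hT₁ : IsClosed {q : P × I | q.1 ∈ T} := hT.preimage continuous_fst
  obtain ⟨a, a0, aT, ha⟩ := exists_glue_box hT₁ H (s := fun q ↦ p q.1.2) (by fun_prop)
    (fun q hq ↦ HT _ hq _)
  obtain ⟨a', a'a, a'1, ha'⟩ := exists_glue_lid hT₁ ha H'
    (fun q hq ↦ (aT q hq 1).trans (HT' _ hq _).symm)
  have a'0 (q) : a' (q, 0) = H q := (a'a (Or.inl rfl)).trans (a0 q)
  have a'T (q : P × I) (hq : q.1 ∈ T) (s) : a' (q, s) = p q.2 :=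
    (a'a (x := (q, s)) (Or.inr hq)).trans (aT q hq s)
  obtain ⟨c, -, hc⟩ := hT'.exists_extension G (s := fun q ↦ a' ((q.1.1, q.2), q.1.2))
    (ha'.comp (by fun_prop) fun q hq ↦ hq) (by
      rintro ⟨q, s⟩ (rfl | rfl | hq)
      · rw [a'0, G0, H0]
      · rw [a'1, G1, H0']
      · exact (GT q hq s).trans (a'T (q, 0) hq s).symm)
  refine ⟨c.comp ((ContinuousMap.id (P × I)).prodMk (.const (P × I) 1)),
    fun q ↦ ?_, fun q ↦ ?_, fun q hq t ↦ ?_⟩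
  · exact (hc _ (Or.inl rfl) 1).trans ((a'0 _).trans (H1 q))
  · exact (hc _ (Or.inr (Or.inl rfl)) 1).trans ((a'1 _).trans (H1' q))
  · exact (hc _ (Or.inr (Or.inr hq)) 1).trans (a'T (q, 1) hq t)

lemma PiInjective.of_path (hT : HasHomotopyExtension T)
    (hT' : HasHomotopyExtension (cylinderBoundary T)) (p : C(I, X)) (h : PiInjective T f (p 0)) :
    PiInjective T f (p 1) := by
  intro γ₀ γ₁ hγ₀ hγ₁ H
  let p' : C(I, X) := p.comp ⟨unitInterval.symm, continuous_symm⟩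
  have hp' : p'.comp ⟨unitInterval.symm, continuous_symm⟩ = p := by ext; simp [p']
  obtain ⟨β₀, hβ₀, A₀⟩ := hT.exists_homotopicAlong (p := p') (γ₀ := γ₀) (by simpa [p'] using hγ₀)
  obtain ⟨β₁, hβ₁, A₁⟩ := hT.exists_homotopicAlong (p := p') (γ₀ := γ₁) (by simpa [p'] using hγ₁)
  have hfβ := (A₀.map f).of_homotopic hT.1 hT' (A₁.map f) (by simpa [p'] using H)
  have hβ := h β₀ β₁ (by simpa [p'] using hβ₀) (by simpa [p'] using hβ₁) (by simpa [p'] using hfβ)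
  exact (hp' ▸ A₀.symm).of_homotopic hT.1 hT' (hp' ▸ A₁.symm) hβ

lemma PiSurjective.of_path (hT : HasHomotopyExtension T)
    (hT' : HasHomotopyExtension (cylinderBoundary T)) (p : C(I, X)) (h : PiSurjective T f (p 0)) :
    PiSurjective T f (p 1) := by
  intro γ hγ
  let p' : C(I, Y) := (f.comp p).comp ⟨unitInterval.symm, continuous_symm⟩
  have hp' : p'.comp ⟨unitInterval.symm, continuous_symm⟩ = f.comp p := by ext; simp [p']
  obtain ⟨δ, hδ, A⟩ := hT.exists_homotopicAlong (p := p') (γ₀ := γ) (by simpa [p'] using hγ)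
  obtain ⟨γ', hγ', H⟩ := h δ (by simpa [p'] using hδ)
  obtain ⟨β, hβ, B⟩ := hT.exists_homotopicAlong hγ'
  exact ⟨β, hβ, (B.map f).of_homotopic hT.1 hT' (hp' ▸ A.symm) H⟩

end BasePoint

section Contractible

lemma exists_contraction (P : Type*) [TopologicalSpace P] [ContractibleSpace P] :
    ∃ (p₀ : P) (K : C(P × I, P)), (∀ p, K (p, 0) = p) ∧ ∀ p, K (p, 1) = p₀ := by
  obtain ⟨p₀, ⟨K⟩⟩ := id_nullhomotopic P
  exact ⟨p₀, K.toContinuousMap.comp ⟨Prod.swap, by fun_prop⟩, fun p ↦ K.apply_zero p,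
    fun p ↦ K.apply_one p⟩

instance contractibleSpace_unitInterval : ContractibleSpace I :=
  (convex_Icc (0 : ℝ) 1).contractibleSpace ⟨0, unitInterval.zero_mem⟩

variable [ContractibleSpace P]

/-- Contracting `P` deforms the lifting problem into one in which the partial lift is constant;
that one is solved up to homotopy by assumption. -/
lemma PiSurjective.exists_lift_eqOn (hT : HasHomotopyExtension T)
    (hf : LiftsPair (cylinderBox T) f) (hs : ∀ x, PiSurjective T f x) (b : C(P, Y)) (c : C(P, X))
    (hcb : ∀ p ∈ T, f (c p) = b p) : ∃ c' : C(P, X), (∀ p, f (c' p) = b p) ∧ EqOn c' c T := by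
  obtain ⟨p₀, K, K0, K1⟩ := exists_contraction P
  obtain ⟨β, β0, βT⟩ := hT.exists_extension b (s := fun q ↦ f (c (K q))) (by fun_prop)
    (by simpa [K0] using fun p hp ↦ (hcb p hp).symm)
  obtain ⟨γ, hγ, Γ, Γ0, Γ1, ΓT⟩ := hs (c p₀) (β.comp ((ContinuousMap.id P).prodMk (.const P 1)))
    (fun q hq ↦ (βT q hq 1).trans (by simp [K1]))
  obtain ⟨c₁, hc₁, hc₁T⟩ := hf.exists_lift_of_homotopy hT.1 Γ (a := fun _ ↦ c p₀)
    continuousOn_const (fun p hp t ↦ (ΓT p hp t).symm) γ (fun p ↦ (Γ0 p).symm) hγ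
  obtain ⟨c', hc', hc'T⟩ := hf.exists_lift_of_homotopy hT.1
    (β.comp ⟨fun q ↦ (q.1, unitInterval.symm q.2), by fun_prop⟩)
    (a := fun q ↦ c (K (q.1, unitInterval.symm q.2))) (by fun_prop)
    (fun p hp t ↦ (βT p hp _).symm) c₁ (fun p ↦ by simp [hc₁, Γ1])
    (fun p hp ↦ by simp [hc₁T p hp, K1])
  exact ⟨c', fun p ↦ by simp [hc', β0], fun p hp ↦ by simp [hc'T p hp, K0]⟩

lemma HasHomotopyExtension.exists_homotopy_const_cylinderBox (hT : HasHomotopyExtension T)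
    {a : P × I → X} (ha : ContinuousOn a (cylinderBoundary T)) :
    ∃ (x : X) (A : (P × I) × I → X), ContinuousOn A {q | q.1 ∈ cylinderBoundary T} ∧
      (∀ p ∈ cylinderBoundary T, A (p, 0) = a p) ∧ ∀ p ∈ cylinderBox T, A (p, 1) = x := by
  obtain ⟨r, hr, hr'⟩ := hT.2
  obtain ⟨p₀, K, K0, K1⟩ := exists_contraction (P × I)
  have hK : Continuous fun q ↦ a (r (K q)) := ha.comp_continuous (by fun_prop)
    (fun q ↦ cylinderBox_subset_cylinderBoundary (hr _))
  have ha₁ : Continuous fun p ↦ a (p, 1) :=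
    ha.comp_continuous (by fun_prop) (fun p ↦ Or.inr (Or.inl rfl))
  obtain ⟨g, g0, gT⟩ := hT.exists_extension ⟨_, ha₁⟩ (s := fun q ↦ a (r (K ((q.1, 1), q.2))))
    (hK.comp (f := fun q : P × I ↦ (((q.1, 1), q.2) : (P × I) × I)) (by fun_prop)).continuousOn
    (fun p hp ↦ by
      have := hr' (p, 1) (Or.inr hp)
      simp [K0, this])
  obtain ⟨A, A₁, A₂, hA⟩ := exists_glue (S₁ := {q : (P × I) × I | q.1 ∈ cylinderBox T})
    (S₂ := {q | q.1.2 = 1}) ((isClosed_cylinderBox hT.1).preimage continuous_fst)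
    (isClosed_eq (by fun_prop) continuous_const) hK.continuousOn
    (a₂ := fun q ↦ g (q.1.1, q.2)) (by fun_prop) (by
      rintro ⟨⟨p, t⟩, s⟩ hp rfl
      exact (gT p (hp.resolve_left one_ne_zero) s).symm)
  refine ⟨a (r p₀), A, hA.mono fun q hq ↦ (cylinderBoundary_eq_union (T := T)).le hq, ?_,
    fun p hp ↦ (A₁ (x := (p, 1)) hp).trans (by simp [K1])⟩
  rw [cylinderBoundary_eq_union]
  rintro ⟨p, t⟩ (hp | rfl)
  · simpa [K0, hr' _ hp] using A₁ (x := ((p, t), 0)) hp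
  · simpa [g0] using A₂ (x := ((p, 1), 0)) rfl

/-- A map defined on the boundary of the cylinder is deformed to one which is constant on the box;
its restriction to the lid represents the obstruction to extending it, and the image of the latter
under `f` vanishes. -/
lemma PiInjective.exists_extension (hT : HasHomotopyExtension T)
    (hT' : HasHomotopyExtension (cylinderBoundary T)) (hi : ∀ x, PiInjective T f x)
    (b : C(P × I, Y)) {a : P × I → X} (ha : ContinuousOn a (cylinderBoundary T))
    (hab : ∀ p ∈ cylinderBoundary T, f (a p) = b p) :
    ∃ c : C(P × I, X), EqOn c a (cylinderBoundary T) := by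
  obtain ⟨x, A, hA, A0, A1⟩ := hT.exists_homotopy_const_cylinderBox ha
  obtain ⟨β, -, hβ⟩ := hT'.exists_extension b (s := fun q ↦ f (A q))
    (f.continuous.comp_continuousOn hA) (fun p hp ↦ by rw [A0 p hp, hab p hp])
  have hα : Continuous fun q ↦ A ((q, 1), 1) :=
    hA.comp_continuous (by fun_prop) (fun q ↦ Or.inr (Or.inl rfl))
  obtain ⟨H, H0, H1, HT⟩ := hi x (.const P x) ⟨_, hα⟩ (fun _ _ ↦ rfl)
    (fun q hq ↦ A1 (q, 1) (Or.inr hq))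
    ⟨β.comp ((ContinuousMap.id (P × I)).prodMk (.const (P × I) 1)),
      fun q ↦ (hβ _ (Or.inl rfl) 1).trans (congrArg f (A1 _ (Or.inl rfl))),
      fun q ↦ hβ _ (Or.inr (Or.inl rfl)) 1,
      fun q hq t ↦ (hβ _ (Or.inr (Or.inr hq)) 1).trans (congrArg f (A1 _ (Or.inr hq)))⟩
  obtain ⟨C, -, hC⟩ := hT'.exists_extension H (s := fun q ↦ A (q.1, unitInterval.symm q.2))
    (hA.comp (by fun_prop) fun q hq ↦ hq) (by
      rintro ⟨q, t⟩ (rfl | rfl | hq)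
      · simp [H0, A1 (q, 0) (Or.inl rfl)]
      · simp [H1]
      · simp [HT q hq, A1 (q, t) (Or.inr hq)])
  exact ⟨C.comp ((ContinuousMap.id (P × I)).prodMk (.const (P × I) 1)),
    fun p hp ↦ (hC p hp 1).trans (by simp [A0 p hp])⟩

theorem LiftsPair.cylinderBoundary_of_piInjective_of_piSurjective (hT : HasHomotopyExtension T)
    (hT' : HasHomotopyExtension (cylinderBoundary T))
    (hf : LiftsPair (cylinderBox (cylinderBoundary T)) f) (hi : ∀ x, PiInjective T f x)
    (hs : ∀ x, PiSurjective (cylinderBoundary T) f x) : LiftsPair (cylinderBoundary T) f := by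
  intro b a ha hab
  obtain ⟨c, hca⟩ := PiInjective.exists_extension hT hT' hi b ha hab
  obtain ⟨c', hc', hc'c⟩ := PiSurjective.exists_lift_eqOn hT' hf hs b c
    (fun p hp ↦ by rw [hca hp, hab p hp])
  exact ⟨c', hc', hc'c.trans hca⟩

end Contractible

end HomotopyClasses

/-! ### Cylinders on balls -/

section Balls

open Metric Set Topology unitInterval

variable (E : Type*) [NormedAddCommGroup E]

/-- The closed unit ball of a normed space. -/
abbrev UnitBall : Type _ := closedBall (0 : E) 1

/-- The boundary sphere of the unit ball, as a subset of the unit ball. -/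
def ballBoundary : Set (UnitBall E) := {q | ‖(q : E)‖ = 1}

variable {E}

lemma norm_unitBall_le (q : UnitBall E) : ‖(q : E)‖ ≤ 1 := mem_closedBall_zero_iff.1 q.2

lemma isClosed_ballBoundary : IsClosed (ballBoundary E) :=
  isClosed_eq (by fun_prop) continuous_const

lemma abs_two_mul_sub_one_eq_one_iff (t : I) : |2 * (t : ℝ) - 1| = 1 ↔ t = 0 ∨ t = 1 := by
  rw [abs_eq zero_le_one, or_comm, Subtype.ext_iff, Subtype.ext_iff, Icc.coe_zero, Icc.coe_one]
  refine or_congr ?_ ?_ <;> constructor <;> intro h <;> linarith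

variable (E) in
/-- The cylinder on the unit ball of `E` is the unit ball of `E × ℝ`, which carries the maximum
norm. -/
noncomputable def cylinderHomeomorph : UnitBall E × I ≃ₜ UnitBall (E × ℝ) where
  toFun p := ⟨(p.1, 2 * p.2 - 1), by
    rw [mem_closedBall_zero_iff, Prod.norm_def, max_le_iff, Real.norm_eq_abs, abs_le]
    exact ⟨norm_unitBall_le _, by linarith [p.2.2.1], by linarith [p.2.2.2]⟩⟩
  invFun q := (⟨q.1.1, mem_closedBall_zero_iff.2 ((norm_fst_le _).trans (norm_unitBall_le q))⟩,
    ⟨(q.1.2 + 1) / 2, by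
      have := (norm_snd_le _).trans (norm_unitBall_le q)
      rw [Real.norm_eq_abs, abs_le] at this
      constructor <;> linarith⟩)
  left_inv p := by ext <;> simp
  right_inv q := by
    ext
    · simp
    · simp only; ring
  continuous_toFun := by fun_prop
  continuous_invFun := by fun_prop

lemma cylinderHomeomorph_preimage_ballBoundary :
    cylinderHomeomorph E ⁻¹' ballBoundary (E × ℝ) = cylinderBoundary (ballBoundary E) := by
  ext p
  have h₁ : |2 * (p.2 : ℝ) - 1| ≤ 1 := by
    rw [abs_le]
    constructor <;> linarith [p.2.2.1, p.2.2.2]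
  change max ‖(p.1 : E)‖ |2 * (p.2 : ℝ) - 1| = 1 ↔ p.2 = 0 ∨ p.2 = 1 ∨ ‖(p.1 : E)‖ = 1
  rw [← or_assoc, ← abs_two_mul_sub_one_eq_one_iff]
  constructor
  · intro h
    rcases max_choice ‖(p.1 : E)‖ |2 * (p.2 : ℝ) - 1| with h' | h'
    · exact Or.inr (h'.symm.trans h)
    · exact Or.inl (h'.symm.trans h)
  · rintro (h | h)
    · rw [h, max_eq_right (norm_unitBall_le p.1)]
    · rw [h, max_eq_left h₁]

/-- The scaling factor by which the projection from `(0, 2)` onto the box divides. -/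
noncomputable def boxScale (p : UnitBall E × I) : ℝ := max ‖(p.1 : E)‖ ((2 - p.2) / 2)

lemma boxScale_pos (p : UnitBall E × I) : 0 < boxScale p :=
  lt_of_lt_of_le (by linarith [p.2.2.2]) (le_max_right _ _)

lemma boxScale_le_one (p : UnitBall E × I) : boxScale p ≤ 1 :=
  max_le (norm_unitBall_le _) (by linarith [p.2.2.1])

lemma continuous_boxScale : Continuous (boxScale : UnitBall E × I → ℝ) := by
  unfold boxScale; fun_prop

lemma boxScale_eq_one {p : UnitBall E × I} (hp : p ∈ cylinderBox (ballBoundary E)) :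
    boxScale p = 1 := by
  rcases hp with hp | (hp : ‖(p.1 : E)‖ = 1)
  · rw [boxScale, hp]
    simpa using norm_unitBall_le p.1
  · rw [boxScale, hp]
    exact max_eq_left (by linarith [p.2.2.1])

/-- The factor by which `boxFlow` dilates at time `s`. -/
noncomputable def boxFlowScale (p : (UnitBall E × I) × I) : ℝ :=
  max (1 - (p.2 : ℝ)) (boxScale p.1) / boxScale p.1

lemma one_le_boxFlowScale (p : (UnitBall E × I) × I) : 1 ≤ boxFlowScale p :=
  (one_le_div (boxScale_pos _)).2 (le_max_right _ _)

lemma boxFlowScale_le (p : (UnitBall E × I) × I) : boxFlowScale p ≤ (boxScale p.1)⁻¹ := by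
  rw [boxFlowScale, div_eq_mul_inv]
  exact mul_le_of_le_one_left (inv_nonneg.2 (boxScale_pos _).le)
    (max_le (by linarith [p.2.2.1]) (boxScale_le_one _))

lemma continuous_boxFlowScale : Continuous (boxFlowScale : (UnitBall E × I) × I → ℝ) :=
  Continuous.div (by have := continuous_boxScale (E := E); fun_prop)
    (continuous_boxScale.comp continuous_fst) fun _ ↦ (boxScale_pos _).ne'

variable [NormedSpace ℝ E]

instance contractibleSpace_unitBall : ContractibleSpace (UnitBall E) :=
  (convex_closedBall (0 : E) 1).contractibleSpace ⟨0, by simp⟩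

/-- The flow of the cylinder `B × I` along the lines through the point `(0, 2)`, towards this
point, starting with the projection onto the box `B × {0} ∪ S × I`. A point of the cylinder is
reached from its projection exactly at the time `1 - boxScale p`. -/
noncomputable def boxFlow : C((UnitBall E × I) × I, UnitBall E × I) where
  toFun p := (⟨boxFlowScale p • (p.1.1 : E), by
      have h := mul_le_mul (boxFlowScale_le p)
        (le_max_left ‖(p.1.1 : E)‖ ((2 - (p.1.2 : ℝ)) / 2)) (norm_nonneg _)
        (inv_nonneg.2 (boxScale_pos _).le)
      change _ ≤ (boxScale p.1)⁻¹ * boxScale p.1 at h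
      rw [inv_mul_cancel₀ (boxScale_pos p.1).ne'] at h
      rwa [mem_closedBall_zero_iff, norm_smul,
        Real.norm_of_nonneg (zero_le_one.trans (one_le_boxFlowScale p))]⟩,
    ⟨2 - boxFlowScale p * (2 - p.1.2), by
      have h := mul_le_mul (boxFlowScale_le p) (le_max_right ‖(p.1.1 : E)‖ ((2 - (p.1.2 : ℝ)) / 2))
        (by linarith [p.1.2.2.2]) (inv_nonneg.2 (boxScale_pos _).le)
      change _ ≤ (boxScale p.1)⁻¹ * boxScale p.1 at h
      rw [inv_mul_cancel₀ (boxScale_pos p.1).ne'] at h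
      constructor <;> nlinarith [one_le_boxFlowScale p, p.1.2.2.2]⟩)
  continuous_toFun := by
    have := continuous_boxFlowScale (E := E)
    fun_prop

lemma boxFlow_eq_self {p : (UnitBall E × I) × I} (hp : 1 - (p.2 : ℝ) = boxScale p.1) :
    boxFlow p = p.1 := by
  have : boxFlowScale p = 1 := by
    rw [boxFlowScale, hp, max_self, div_self (boxScale_pos _).ne']
  ext <;> simp [boxFlow, this]

lemma boxFlow_zero_mem (p : UnitBall E × I) :
    boxFlow (p, 0) ∈ cylinderBox (ballBoundary E) := by
  have hσ : boxFlowScale (p, 0) = (boxScale p)⁻¹ := by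
    simp [boxFlowScale, max_eq_left (boxScale_le_one p)]
  have h := (boxScale_pos p).ne'
  rcases max_choice ‖(p.1 : E)‖ ((2 - p.2) / 2) with h' | h' <;> change boxScale p = _ at h'
  · right
    change ‖boxFlowScale (p, 0) • (p.1 : E)‖ = 1
    rw [hσ, norm_smul, norm_inv, h', norm_norm, inv_mul_cancel₀ (h' ▸ h)]
  · left
    ext
    change 2 - boxFlowScale (p, 0) * (2 - (p.2 : ℝ)) = 0
    rw [hσ, sub_eq_zero, eq_inv_mul_iff_mul_eq₀ h, h']
    ring

/-- The time at which `boxFlow` passes through a given point of the cylinder. -/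
noncomputable def boxTime : C(UnitBall E × I, I) where
  toFun p := ⟨1 - boxScale p, by linarith [boxScale_le_one p], by linarith [boxScale_pos p]⟩
  continuous_toFun := by have := continuous_boxScale (E := E); fun_prop

lemma isRetract_cylinderBox_ballBoundary : IsRetract (cylinderBox (ballBoundary E)) :=
  ⟨boxFlow.comp ((ContinuousMap.id _).prodMk (.const _ 0)), boxFlow_zero_mem,
    fun p hp ↦ boxFlow_eq_self (p := (p, 0)) (by simp [boxScale_eq_one hp])⟩

variable {X Y : Type*} [TopologicalSpace X] [TopologicalSpace Y] {f : C(X, Y)}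

lemma LiftsPair.cylinderBox_ballBoundary (h : LiftsPair (cylinderBase (UnitBall E × I)) f) :
    LiftsPair (cylinderBox (ballBoundary E)) f := by
  refine h.of_retract ((ContinuousMap.id _).prodMk boxTime) boxFlow
    (fun p ↦ boxFlow_eq_self (by simp [boxTime])) (fun p hp ↦ ?_) (fun p hp ↦ ?_)
  · ext
    simp [boxTime, boxScale_eq_one hp]
  · obtain ⟨p, s⟩ := p
    obtain rfl : s = 0 := hp
    exact boxFlow_zero_mem p

/-- The embedding of the cylinder into itself which narrows its upper part. -/
noncomputable def narrowCylinder : C(UnitBall E × I, UnitBall E × I) where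
  toFun p := (⟨(1 - p.2 / 2 : ℝ) • (p.1 : E), by
    have h : 0 ≤ 1 - (p.2 : ℝ) / 2 := by linarith [p.2.2.2]
    rw [mem_closedBall_zero_iff, norm_smul, Real.norm_of_nonneg h]
    exact mul_le_one₀ (by linarith [p.2.2.1]) (norm_nonneg _) (norm_unitBall_le _)⟩, p.2)
  continuous_toFun := by fun_prop

/-- A retraction of the embedding `narrowCylinder`, which sends the sides to the bottom. -/
noncomputable def widenCylinder : C(UnitBall E × I, UnitBall E × I) where
  toFun p := (⟨(max ‖(p.1 : E)‖ (1 - p.2 / 2))⁻¹ • (p.1 : E), by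
      have h : 0 < max ‖(p.1 : E)‖ (1 - p.2 / 2) := lt_max_of_lt_right (by linarith [p.2.2.2])
      rw [mem_closedBall_zero_iff, norm_smul, norm_inv, Real.norm_of_nonneg h.le,
        inv_mul_le_one₀ h]
      exact le_max_left _ _⟩,
    ⟨min p.2 (2 * (1 - ‖(p.1 : E)‖)), le_min p.2.2.1 (by linarith [norm_unitBall_le p.1]),
      (min_le_left _ _).trans p.2.2.2⟩)
  continuous_toFun := by
    have : Continuous fun p : UnitBall E × I ↦ (max ‖(p.1 : E)‖ (1 - p.2 / 2 : ℝ))⁻¹ :=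
      Continuous.inv₀ (by fun_prop)
        (fun p ↦ (lt_max_of_lt_right (by linarith [p.2.2.2])).ne')
    fun_prop

lemma widenCylinder_narrowCylinder (p : UnitBall E × I) :
    widenCylinder (narrowCylinder p) = p := by
  have h : 0 < 1 - (p.2 : ℝ) / 2 := by linarith [p.2.2.2]
  have hn : ‖(1 - p.2 / 2 : ℝ) • (p.1 : E)‖ ≤ 1 - p.2 / 2 := by
    rw [norm_smul, Real.norm_of_nonneg h.le]
    exact mul_le_of_le_one_right h.le (norm_unitBall_le _)
  ext
  · change (max ‖(1 - p.2 / 2 : ℝ) • (p.1 : E)‖ (1 - p.2 / 2))⁻¹ •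
      (1 - p.2 / 2 : ℝ) • (p.1 : E) = _
    rw [max_eq_right hn, inv_smul_smul₀ h.ne']
  · refine min_eq_left ?_
    change (p.2 : ℝ) ≤ 2 * (1 - ‖(1 - p.2 / 2 : ℝ) • (p.1 : E)‖)
    linarith

lemma LiftsPair.cylinderBase_unitBall (h : LiftsPair (cylinderBox (ballBoundary E)) f) :
    LiftsPair (cylinderBase (UnitBall E)) f := by
  refine h.of_retract narrowCylinder widenCylinder widenCylinder_narrowCylinder
    (fun p hp ↦ Or.inl hp) ?_
  rintro ⟨q, t⟩ (rfl | (hq : ‖(q : E)‖ = 1)) <;> ext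
  · exact min_eq_left (by simpa using norm_unitBall_le q)
  · simpa [widenCylinder, hq] using t.2.1

lemma hasHomotopyExtension_ballBoundary : HasHomotopyExtension (ballBoundary E) :=
  ⟨isClosed_ballBoundary, isRetract_cylinderBox_ballBoundary⟩

lemma hasHomotopyExtension_cylinderBoundary_ballBoundary :
    HasHomotopyExtension (cylinderBoundary (ballBoundary E)) :=
  cylinderHomeomorph_preimage_ballBoundary (E := E) ▸
    hasHomotopyExtension_ballBoundary.preimage_homeomorph (cylinderHomeomorph E)

lemma exists_unitBall_homeomorph {F : Type*} [NormedAddCommGroup F] [NormedSpace ℝ F]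
    [FiniteDimensional ℝ E] [FiniteDimensional ℝ F]
    (h : Module.finrank ℝ E = Module.finrank ℝ F) :
    ∃ e : UnitBall E ≃ₜ UnitBall F, e ⁻¹' ballBoundary F = ballBoundary E := by
  let l : E ≃L[ℝ] F := ContinuousLinearEquiv.ofFinrankEq h
  let s : Set F := l '' closedBall (0 : E) 1
  have hs : Convex ℝ s := (convex_closedBall (0 : E) 1).linear_image l.toLinearMap
  have hs_closed : IsClosed s := l.toHomeomorph.isClosedMap _ isClosed_closedBall
  have hs_interior : (interior s).Nonempty := by
    rw [show s = l.toHomeomorph '' closedBall (0 : E) 1 from rfl, ← l.toHomeomorph.image_interior]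
    exact ⟨0, 0, mem_interior_iff_mem_nhds.2 (closedBall_mem_nhds _ one_pos), map_zero l⟩
  have hs_bounded : Bornology.IsBounded s := l.lipschitz.isBounded_image isBounded_closedBall
  obtain ⟨e, -, he_closure, he_frontier⟩ :=
    exists_homeomorph_image_interior_closure_frontier_eq_unitBall hs hs_interior hs_bounded
  rw [hs_closed.closure_eq] at he_closure
  let e' : E ≃ₜ F := l.toHomeomorph.trans e
  have he_ball : e' '' closedBall (0 : E) 1 = closedBall (0 : F) 1 := by
    rw [← he_closure, ← image_comp]; rfl
  have he_sphere : e' '' sphere (0 : E) 1 = sphere (0 : F) 1 := by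
    rw [← frontier_closedBall _ one_ne_zero, ← he_frontier,
      show s = l.toHomeomorph '' closedBall (0 : E) 1 from rfl, ← l.toHomeomorph.image_frontier,
      ← image_comp]
    rfl
  have hmem (p : E) : p ∈ closedBall (0 : E) 1 ↔ e' p ∈ closedBall (0 : F) 1 := by
    rw [← he_ball, e'.injective.mem_set_image]
  refine ⟨e'.subtype hmem, ?_⟩
  ext p
  have : (p : E) ∈ sphere (0 : E) 1 ↔ e' p ∈ sphere (0 : F) 1 := by
    rw [← he_sphere, e'.injective.mem_set_image]
  simpa [ballBoundary] using this.symm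

end Balls

/-! ### Homotopy groups and Serre fibrations of spaces -/

section HomotopyGroups

open Metric Set Topology unitInterval

/-- The standard cube is homeomorphic to the unit ball for the maximum norm. -/
noncomputable def cubeHomeomorph (n : ℕ) : (Fin n → I) ≃ₜ UnitBall (Fin n → ℝ) where
  toFun q := ⟨fun i ↦ 2 * q i - 1, by
    rw [mem_closedBall_zero_iff, pi_norm_le_iff_of_nonneg zero_le_one]
    intro i
    rw [Real.norm_eq_abs, abs_le]
    constructor <;> linarith [(q i).2.1, (q i).2.2]⟩
  invFun q i := ⟨(q.1 i + 1) / 2, by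
    have := (norm_le_pi_norm _ i).trans (norm_unitBall_le q)
    rw [Real.norm_eq_abs, abs_le] at this
    constructor <;> linarith⟩
  left_inv q := by ext; simp
  right_inv q := by ext; simp only; ring
  continuous_toFun := by fun_prop
  continuous_invFun := continuous_pi fun i ↦ Continuous.subtype_mk
    ((((continuous_apply i).comp continuous_subtype_val).add continuous_const).div_const _) _

lemma cubeHomeomorph_preimage_ballBoundary (n : ℕ) :
    cubeHomeomorph n ⁻¹' ballBoundary (Fin n → ℝ) = Cube.boundary (Fin n) := by
  ext q
  have h (i : Fin n) : ‖(cubeHomeomorph n q : Fin n → ℝ) i‖ = 1 ↔ q i = 0 ∨ q i = 1 :=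
    abs_two_mul_sub_one_eq_one_iff (q i)
  constructor
  · intro hq
    by_contra hq'
    refine (((pi_norm_lt_iff zero_lt_one).2 fun i ↦ ?_).ne : _ ≠ (1 : ℝ)) hq
    exact lt_of_le_of_ne ((norm_le_pi_norm _ i).trans (norm_unitBall_le _))
      fun hi ↦ hq' ⟨i, (h i).1 hi⟩
  · rintro ⟨i, hi⟩
    exact le_antisymm (norm_unitBall_le _) (((h i).2 hi).ge.trans (norm_le_pi_norm _ i))

variable {X Y : Type u} [TopologicalSpace X] [TopologicalSpace Y] (f : C(X, Y))

lemma injective_homotopyGroupMap_iff (n : ℕ) (x : X) :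
    Function.Injective (homotopyGroupMap f n x) ↔ PiInjective (ballBoundary (Fin n → ℝ)) f x := by
  rw [← piInjective_preimage_homeomorph_iff (cubeHomeomorph n),
    cubeHomeomorph_preimage_ballBoundary]
  have hf {γ : C(Fin n → I, X)} (hγ : ∀ q ∈ Cube.boundary (Fin n), γ q = x) :
      ∀ q ∈ Cube.boundary (Fin n), f.comp γ q = f x := fun q hq ↦ congrArg f (hγ q hq)
  constructor
  · intro h γ₀ γ₁ hγ₀ hγ₁ H
    rw [HomotopicAlong.const_iff_homotopicRel (hf hγ₀)] at H
    rw [HomotopicAlong.const_iff_homotopicRel hγ₀]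
    exact Quotient.exact (h (a₁ := Quotient.mk _ ⟨γ₀, hγ₀⟩) (a₂ := Quotient.mk _ ⟨γ₁, hγ₁⟩)
      (Quotient.sound H))
  · rintro h ⟨γ₀, hγ₀⟩ ⟨γ₁, hγ₁⟩ H
    refine Quotient.sound ((HomotopicAlong.const_iff_homotopicRel hγ₀).1 (h _ _ hγ₀ hγ₁ ?_))
    exact (HomotopicAlong.const_iff_homotopicRel (hf hγ₀)).2 (Quotient.exact H)

lemma surjective_homotopyGroupMap_iff (n : ℕ) (x : X) :
    Function.Surjective (homotopyGroupMap f n x) ↔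
      PiSurjective (ballBoundary (Fin n → ℝ)) f x := by
  rw [← piSurjective_preimage_homeomorph_iff (cubeHomeomorph n),
    cubeHomeomorph_preimage_ballBoundary]
  have hf {γ : C(Fin n → I, X)} (hγ : ∀ q ∈ Cube.boundary (Fin n), γ q = x) :
      ∀ q ∈ Cube.boundary (Fin n), f.comp γ q = f x := fun q hq ↦ congrArg f (hγ q hq)
  constructor
  · intro h γ hγ
    obtain ⟨⟨γ', hγ'⟩, H⟩ := h (Quotient.mk _ ⟨γ, hγ⟩)
    exact ⟨γ', hγ', (HomotopicAlong.const_iff_homotopicRel (hf hγ')).2 (Quotient.exact H)⟩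
  · rintro h ⟨γ, hγ⟩
    obtain ⟨γ', hγ', H⟩ := h γ hγ
    exact ⟨Quotient.mk _ ⟨γ', hγ'⟩,
      Quotient.sound ((HomotopicAlong.const_iff_homotopicRel (hf hγ')).1 H)⟩

lemma surjective_zerothHomotopyMap_iff :
    Function.Surjective (zerothHomotopyMap f) ↔ ∀ y, ∃ x, Joined (f x) y := by
  constructor
  · intro h y
    obtain ⟨⟨x⟩, hx⟩ := h (Quotient.mk _ y)
    exact ⟨x, Quotient.exact hx⟩
  · rintro h ⟨y⟩
    obtain ⟨x, hx⟩ := h y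
    exact ⟨Quotient.mk _ x, Quotient.sound hx⟩

lemma zerothHomotopyMap_comp_pi0EquivZerothHomotopy (x : X) :
    zerothHomotopyMap f ∘ HomotopyGroup.pi0EquivZerothHomotopy (x := x) =
      HomotopyGroup.pi0EquivZerothHomotopy ∘ homotopyGroupMap f 0 x := by
  ext ⟨γ⟩
  rfl

lemma injective_homotopyGroupMap_zero_iff (x : X) :
    Function.Injective (homotopyGroupMap f 0 x) ↔ Function.Injective (zerothHomotopyMap f) := by
  rw [← EquivLike.injective_comp HomotopyGroup.pi0EquivZerothHomotopy (zerothHomotopyMap f),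
    zerothHomotopyMap_comp_pi0EquivZerothHomotopy, EquivLike.comp_injective]

lemma weakHomotopyEquivalences_iff {X Y : TopCat.{u}} (f : X ⟶ Y) :
    weakHomotopyEquivalences f ↔ (∀ y, ∃ x, Joined (f.hom x) y) ∧
      ∀ (n : ℕ) (x : X), PiInjective (ballBoundary (Fin n → ℝ)) f.hom x ∧
        PiSurjective (ballBoundary (Fin (n + 1) → ℝ)) f.hom x := by
  simp only [weakHomotopyEquivalences, Function.Bijective, ← surjective_zerothHomotopyMap_iff,
    ← surjective_homotopyGroupMap_iff, ← injective_homotopyGroupMap_iff]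
  constructor
  · rintro ⟨⟨h₀, h₁⟩, h₂⟩
    refine ⟨h₁, fun n x ↦ ⟨?_, (h₂ n x).2⟩⟩
    cases n
    exacts [(injective_homotopyGroupMap_zero_iff f.hom x).2 h₀, (h₂ _ x).1]
  · rintro ⟨h₁, h₂⟩
    refine ⟨⟨fun a b hab ↦ ?_, h₁⟩, fun n x ↦ ⟨(h₂ (n + 1) x).1, (h₂ n x).2⟩⟩
    obtain ⟨x, -⟩ := Quotient.exists_rep a
    exact (injective_homotopyGroupMap_zero_iff f.hom x).1 (h₂ 0 x).1 hab

lemma zerothHomotopyMap_comp {Z : Type u} [TopologicalSpace Z] (g : C(Y, Z)) :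
    zerothHomotopyMap (g.comp f) = zerothHomotopyMap g ∘ zerothHomotopyMap f := by
  ext ⟨γ⟩; rfl

lemma homotopyGroupMap_comp {Z : Type u} [TopologicalSpace Z] (g : C(Y, Z)) (n : ℕ) (x : X) :
    homotopyGroupMap (g.comp f) n x = homotopyGroupMap g n (f x) ∘ homotopyGroupMap f n x := by
  ext ⟨γ⟩; rfl

variable {f} in
lemma bijective_homotopyGroupMap_of_joined (n : ℕ) {x x' : X} (h : Joined x x')
    (hx : Function.Bijective (homotopyGroupMap f n x)) :
    Function.Bijective (homotopyGroupMap f n x') := by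
  obtain ⟨p⟩ := h
  rw [Function.Bijective, injective_homotopyGroupMap_iff, surjective_homotopyGroupMap_iff] at hx ⊢
  have hi := PiInjective.of_path hasHomotopyExtension_ballBoundary
    hasHomotopyExtension_cylinderBoundary_ballBoundary (p : C(I, X)) (by simpa using hx.1)
  have hs := PiSurjective.of_path hasHomotopyExtension_ballBoundary
    hasHomotopyExtension_cylinderBoundary_ballBoundary (p : C(I, X)) (by simpa using hx.2)
  exact ⟨by simpa using hi, by simpa using hs⟩

instance : weakHomotopyEquivalences.{u}.HasTwoOutOfThreeProperty where
  comp_mem f g hf hg := by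
    refine ⟨?_, fun n x ↦ ?_⟩
    · rw [TopCat.hom_comp, zerothHomotopyMap_comp]
      exact hg.1.comp hf.1
    · rw [TopCat.hom_comp, homotopyGroupMap_comp]
      exact (hg.2 _ _).comp (hf.2 _ _)
  of_postcomp f g hg hfg := by
    simp only [weakHomotopyEquivalences, TopCat.hom_comp, zerothHomotopyMap_comp,
      homotopyGroupMap_comp] at hfg
    exact ⟨(Function.Bijective.of_comp_iff' hg.1 _).1 hfg.1,
      fun n x ↦ (Function.Bijective.of_comp_iff' (hg.2 n _) _).1 (hfg.2 n x)⟩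
  of_precomp f g hf hfg := by
    simp only [weakHomotopyEquivalences, TopCat.hom_comp, zerothHomotopyMap_comp,
      homotopyGroupMap_comp] at hfg
    refine ⟨(Function.Bijective.of_comp_iff _ hf.1).1 hfg.1, fun n y ↦ ?_⟩
    obtain ⟨x, hx⟩ := (surjective_zerothHomotopyMap_iff _).1 hf.1.2 y
    exact bijective_homotopyGroupMap_of_joined _ hx
      ((Function.Bijective.of_comp_iff _ (hf.2 n x)).1 (hfg.2 n x))

lemma weakHomotopyEquivalences_of_deformationRetraction {X Y : TopCat.{u}} (f : X ⟶ Y) (r : Y ⟶ X)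
    (hr : f ≫ r = 𝟙 X) (h : C(Y × I, Y)) (h0 : ∀ y, h (y, 0) = y)
    (h1 : ∀ y, h (y, 1) = f (r y)) (hf : ∀ x t, h (f x, t) = f x) :
    weakHomotopyEquivalences f := by
  have hr' (x : X) : r.hom (f.hom x) = x := congr($hr x)
  refine (weakHomotopyEquivalences_iff f).2 ⟨fun y ↦ ⟨r y, ?_⟩, fun n x ↦
    ⟨PiInjective.of_retraction hr' x, PiSurjective.of_deformationRetraction hr' h0 h1 hf x⟩⟩
  exact Joined.symm ⟨⟨⟨fun t ↦ h (y, t), by fun_prop⟩, h0 y, h1 y⟩⟩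

lemma weakHomotopyEquivalences_of_isIso {X Y : TopCat.{u}} (f : X ⟶ Y) [IsIso f] :
    weakHomotopyEquivalences f :=
  weakHomotopyEquivalences_of_deformationRetraction f (inv f) (IsIso.hom_inv_id f)
    ⟨Prod.fst, continuous_fst⟩ (fun _ ↦ rfl) (fun y ↦ congr($(IsIso.inv_hom_id f) y).symm)
    fun _ _ ↦ rfl

end HomotopyGroups

section SerreFibrations

open Metric Set Topology unitInterval

variable {X Y : TopCat.{u}} {f : X ⟶ Y}

lemma liftsPair_range_of_hasLiftingProperty {A B : TopCat.{u}} {i : A ⟶ B} (hi : IsEmbedding i)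
    (h : HasLiftingProperty i f) : LiftsPair (range i) f.hom := by
  intro b a ha hab
  have sq : CommSq (TopCat.ofHom ⟨a ∘ i, ha.comp_continuous hi.continuous mem_range_self⟩) i f
    (TopCat.ofHom b) := ⟨by ext x; exact hab _ (mem_range_self x)⟩
  refine ⟨sq.lift.hom, fun p ↦ congr($(sq.fac_right) p), ?_⟩
  rintro _ ⟨x, rfl⟩
  exact congr($(sq.fac_left) x)

lemma LiftsPair.hasLiftingProperty {A B : TopCat.{u}} [Nonempty A] {i : A ⟶ B} (hi : IsEmbedding i)
    (h : LiftsPair (range i) f.hom) : HasLiftingProperty i f := by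
  refine ⟨fun {t b} sq ↦ ?_⟩
  let a : B → X := Function.extend i t (fun _ ↦ t (Classical.arbitrary A))
  have hai (p : A) : a (i p) = t p := hi.injective.extend_apply _ _ _
  have ha : ContinuousOn a (range i) := by
    rw [continuousOn_iff_continuous_domRestrict, ← hi.toHomeomorph.comp_continuous_iff',
      show (range i).domRestrict a ∘ hi.toHomeomorph = t from funext hai]
    exact t.hom.continuous
  obtain ⟨c, hc, hc'⟩ := h b.hom a ha (by
    rintro _ ⟨p, rfl⟩
    rw [hai]
    exact congr($(sq.w) p))
  exact ⟨⟨{ l := TopCat.ofHom c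
            fac_left := by ext p; exact (hc' (mem_range_self p)).trans (hai p)
            fac_right := by ext p; exact hc p }⟩⟩

/-- The disk of `TopCat` is, up to a universe lift, the euclidean unit ball. -/
def diskHomeomorph (n : ℕ) : TopCat.disk.{u} n ≃ₜ UnitBall (EuclideanSpace ℝ (Fin n)) :=
  Homeomorph.ulift

lemma isEmbedding_diskBoundaryInclusion (n : ℕ) :
    IsEmbedding (TopCat.diskBoundaryInclusion.{u} n) := by
  have h : IsEmbedding (diskHomeomorph.{u} n ∘ TopCat.diskBoundaryInclusion.{u} n) :=
    (IsEmbedding.inclusion sphere_subset_closedBall).comp Homeomorph.ulift.isEmbedding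
  exact (diskHomeomorph n).isEmbedding.of_comp_iff.1 h

lemma isEmbedding_diskCylinderInclusion (n : ℕ) :
    IsEmbedding (diskCylinderInclusion.{u} n) :=
  IsEmbedding.id.prodMap IsEmbedding.subtypeVal

lemma range_diskBoundaryInclusion (n : ℕ) : range (TopCat.diskBoundaryInclusion.{u} n) =
    diskHomeomorph n ⁻¹' ballBoundary (EuclideanSpace ℝ (Fin n)) := by
  ext p
  constructor
  · rintro ⟨⟨⟨q, hq⟩⟩, rfl⟩
    exact mem_sphere_zero_iff_norm.1 hq
  · intro hp
    exact ⟨⟨⟨(diskHomeomorph n p).1, mem_sphere_zero_iff_norm.2 hp⟩⟩, rfl⟩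

lemma range_diskCylinderInclusion (n : ℕ) :
    range (diskCylinderInclusion.{u} n) = cylinderBase (TopCat.disk.{u} n) := by
  ext p
  constructor
  · rintro ⟨⟨q, t, ht⟩, rfl⟩
    exact ht
  · rintro hp
    exact ⟨(p.1, ⟨p.2, hp⟩), rfl⟩

lemma isEmpty_diskBoundary_zero : IsEmpty (TopCat.diskBoundary.{u} 0) :=
  ⟨fun ⟨q, hq⟩ ↦ by
    rw [Subsingleton.elim q 0, mem_sphere_zero_iff_norm, norm_zero] at hq
    exact zero_ne_one hq⟩

instance (n : ℕ) : Nonempty (TopCat.diskBoundary.{u} (n + 1)) :=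
  ⟨⟨EuclideanSpace.single 0 1, by simp⟩⟩

instance (n : ℕ) : Inhabited (TopCat.disk.{u} n) := ⟨⟨⟨0, by simp⟩⟩⟩

lemma hasLiftingProperty_diskBoundaryInclusion_zero_iff :
    HasLiftingProperty (TopCat.diskBoundaryInclusion.{u} 0) f ↔ Function.Surjective f := by
  have : IsEmpty _ := isEmpty_diskBoundary_zero.{u}
  constructor
  · intro h y
    let t : TopCat.diskBoundary.{u} 0 ⟶ X :=
      TopCat.ofHom ⟨isEmptyElim, continuous_of_const isEmptyElim⟩
    let b : TopCat.disk.{u} 0 ⟶ Y := TopCat.ofHom (.const _ y)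
    have sq : CommSq t (TopCat.diskBoundaryInclusion.{u} 0) f b := ⟨by ext p; exact isEmptyElim p⟩
    exact ⟨sq.lift default, congr($(sq.fac_right) default)⟩
  · refine fun h ↦ ⟨fun {t b} sq ↦ ?_⟩
    obtain ⟨x, hx⟩ := h (b default)
    have hb (p : TopCat.disk.{u} 0) : default = p :=
      (diskHomeomorph 0).injective (Subtype.ext (Subsingleton.elim _ _))
    exact ⟨⟨{ l := TopCat.ofHom (.const _ x)
              fac_left := by ext p; exact isEmptyElim p
              fac_right := by ext p; exact hx.trans (congrArg b (hb p)) }⟩⟩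

lemma serreFibrations_iff : serreFibrations f ↔
    ∀ n, LiftsPair (cylinderBase (UnitBall (EuclideanSpace ℝ (Fin n)))) f.hom := by
  constructor
  · intro h n
    have := liftsPair_range_of_hasLiftingProperty (isEmbedding_diskCylinderInclusion n) (h _ ⟨n⟩)
    rw [range_diskCylinderInclusion] at this
    exact this.preimage_homeomorph ((diskHomeomorph.{u} n).symm.prodCongr (Homeomorph.refl I))
  · rintro h _ _ _ ⟨n⟩
    have : Nonempty (TopCat.of (TopCat.disk.{u} n × ({0} : Set I))) := ⟨(default, ⟨0, rfl⟩)⟩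
    refine LiftsPair.hasLiftingProperty (isEmbedding_diskCylinderInclusion n) ?_
    rw [range_diskCylinderInclusion]
    exact (h n).preimage_homeomorph ((diskHomeomorph.{u} n).prodCongr (Homeomorph.refl I))

lemma LiftsPair.surjective {P : Type*} [TopologicalSpace P] [Nonempty P]
    (h : LiftsPair (cylinderBase P) f.hom) (hf : ∀ y, ∃ x, Joined (f x) y) :
    Function.Surjective f := by
  intro y
  obtain ⟨x, ⟨c⟩⟩ := hf y
  obtain ⟨l, hl, -⟩ := h ((c : C(I, Y)).comp .snd) (fun _ ↦ x) continuousOn_const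
    (by rintro ⟨q, t⟩ (rfl : t = 0); exact c.source.symm)
  exact ⟨l (Classical.arbitrary P, 1), (hl _).trans c.target⟩

section FiniteDimensional

variable (E : Type*) [NormedAddCommGroup E] [NormedSpace ℝ E] [FiniteDimensional ℝ E]

lemma liftsPair_ballBoundary
    (h : (MorphismProperty.ofHoms (fun n ↦ TopCat.diskBoundaryInclusion.{u} n)).rlp f) :
    LiftsPair (ballBoundary E) f.hom := by
  let n := Module.finrank ℝ E
  obtain ⟨e, he⟩ := exists_unitBall_homeomorph (E := E) (F := EuclideanSpace ℝ (Fin n))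
    (by simp [n])
  have h' := liftsPair_range_of_hasLiftingProperty (isEmbedding_diskBoundaryInclusion n) (h _ ⟨n⟩)
  rw [range_diskBoundaryInclusion] at h'
  rw [← he]
  exact h'.preimage_homeomorph (e.trans (diskHomeomorph.{u} n).symm)

lemma serreFibrations.liftsPair (h : serreFibrations f) :
    LiftsPair (cylinderBase (UnitBall E)) f.hom := by
  let n := Module.finrank ℝ E
  obtain ⟨e, -⟩ := exists_unitBall_homeomorph (E := E) (F := EuclideanSpace ℝ (Fin n))
    (by simp [n])
  exact (serreFibrations_iff.1 h n).preimage_homeomorph (e.prodCongr (Homeomorph.refl I))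

lemma serreFibrations.liftsPair_cylinderBox (h : serreFibrations f) :
    LiftsPair (cylinderBox (ballBoundary E)) f.hom :=
  LiftsPair.cylinderBox_ballBoundary <|
    (h.liftsPair (E × ℝ)).preimage_homeomorph ((cylinderHomeomorph E).prodCongr (Homeomorph.refl I))

end FiniteDimensional

/-- In positive dimensions, the ball is a cylinder, and its sphere is the boundary of this
cylinder. -/
lemma hasLiftingProperty_diskBoundaryInclusion_succ {n : ℕ}
    (h : LiftsPair (cylinderBoundary (ballBoundary (Fin n → ℝ))) f.hom) :
    HasLiftingProperty (TopCat.diskBoundaryInclusion.{u} (n + 1)) f := by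
  obtain ⟨e, he⟩ := exists_unitBall_homeomorph (E := EuclideanSpace ℝ (Fin (n + 1)))
    (F := (Fin n → ℝ) × ℝ) (by simp)
  refine LiftsPair.hasLiftingProperty (isEmbedding_diskBoundaryInclusion (n + 1)) ?_
  rw [range_diskBoundaryInclusion, ← he]
  rw [← cylinderHomeomorph_preimage_ballBoundary] at h
  have h' := h.preimage_homeomorph (cylinderHomeomorph (Fin n → ℝ)).symm
  rw [← preimage_comp, Homeomorph.self_comp_symm, preimage_id] at h'
  exact h'.preimage_homeomorph ((diskHomeomorph.{u} (n + 1)).trans e)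

lemma liftsPair_cylinderBoundary_ballBoundary (hw : weakHomotopyEquivalences f)
    (hf : serreFibrations f) (n : ℕ) :
    LiftsPair (cylinderBoundary (ballBoundary (Fin n → ℝ))) f.hom := by
  obtain ⟨-, hw⟩ := (weakHomotopyEquivalences_iff f).1 hw
  refine LiftsPair.cylinderBoundary_of_piInjective_of_piSurjective
    hasHomotopyExtension_ballBoundary hasHomotopyExtension_cylinderBoundary_ballBoundary ?_
    (fun x ↦ (hw n x).1) (fun x ↦ ?_)
  · rw [← cylinderHomeomorph_preimage_ballBoundary]
    exact (hf.liftsPair_cylinderBox ((Fin n → ℝ) × ℝ)).preimage_homeomorph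
      ((cylinderHomeomorph _).prodCongr (Homeomorph.refl I))
  · obtain ⟨e, he⟩ := exists_unitBall_homeomorph (E := (Fin n → ℝ) × ℝ)
      (F := Fin (n + 1) → ℝ) (by simp)
    rw [← cylinderHomeomorph_preimage_ballBoundary, ← he]
    exact (hw n x).2.preimage_homeomorph ((cylinderHomeomorph _).trans e)

theorem rlp_diskBoundaryInclusion_iff :
    (MorphismProperty.ofHoms (fun n ↦ TopCat.diskBoundaryInclusion.{u} n)).rlp f ↔
      weakHomotopyEquivalences f ∧ serreFibrations f := by
  constructor
  · intro h
    have hL (E : Type) [NormedAddCommGroup E] [NormedSpace ℝ E] [FiniteDimensional ℝ E] :=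
      liftsPair_ballBoundary E h
    have hL' (E : Type) [NormedAddCommGroup E] [NormedSpace ℝ E] [FiniteDimensional ℝ E] :
        LiftsPair (cylinderBoundary (ballBoundary E)) f.hom :=
      cylinderHomeomorph_preimage_ballBoundary (E := E) ▸
        (hL (E × ℝ)).preimage_homeomorph (cylinderHomeomorph E)
    refine ⟨(weakHomotopyEquivalences_iff f).2 ⟨fun y ↦ ?_, fun n x ↦ ⟨?_, ?_⟩⟩,
      serreFibrations_iff.2 fun n ↦ LiftsPair.cylinderBase_unitBall
        ((hL _).cylinderBox_of_cylinderBoundary isClosed_ballBoundary (hL' _))⟩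
    · obtain ⟨x, rfl⟩ := hasLiftingProperty_diskBoundaryInclusion_zero_iff.1 (h _ ⟨0⟩) y
      exact ⟨x, Joined.refl _⟩
    · exact (hL' _).piInjective isClosed_ballBoundary x
    · exact (hL _).piSurjective x
  · rintro ⟨hw, hf⟩ _ _ _ ⟨_ | n⟩
    · exact hasLiftingProperty_diskBoundaryInclusion_zero_iff.2
        ((hf.liftsPair ℝ).surjective ((weakHomotopyEquivalences_iff f).1 hw).1)
    · exact hasLiftingProperty_diskBoundaryInclusion_succ
        (liftsPair_cylinderBoundary_ballBoundary hw hf n)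

end SerreFibrations

/-! ### Adjunctions, limits and colimits -/

section ProperMaps

open Filter Topology

variable {X Y : Type*} [TopologicalSpace X] [TopologicalSpace Y]

lemma locallyCompactSpace_of_isProperMap [LocallyCompactSpace X] {f : X → Y} (hf : IsProperMap f)
    (hf' : Function.Surjective f) : LocallyCompactSpace Y where
  local_compact_nhds y U hU := by
    have hU' : f ⁻¹' U ∈ 𝓝ˢ (f ⁻¹' {y}) := by
      rw [← hf.isClosedMap.comap_nhds_eq hf.continuous]
      exact preimage_mem_comap hU
    obtain ⟨V, hV, hyV, hVU⟩ := mem_nhdsSet_iff_exists.1 hU'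
    obtain ⟨L, hL, hyL, hLV⟩ :=
      exists_compact_between (hf.isCompact_preimage isCompact_singleton) hV hyV
    obtain ⟨W, hW, hWL⟩ : interior L ∈ comap f (𝓝 y) := by
      rw [hf.isClosedMap.comap_nhds_eq hf.continuous]
      exact isOpen_interior.mem_nhdsSet.2 hyL
    refine ⟨f '' L, mem_of_superset hW fun z hz ↦ ?_, Set.image_subset_iff.2 (hLV.trans hVU),
      hL.image hf.continuous⟩
    obtain ⟨x, rfl⟩ := hf' z
    exact Set.mem_image_of_mem f (interior_subset (hWL hz))

lemma isProperMap_quotientMk [CompactSpace X] {s : Setoid X}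
    (hs : IsClosed {p : X × X | s p.1 p.2}) : IsProperMap (Quotient.mk s) := by
  have saturation_eq (C : Set X) : Quotient.mk s ⁻¹' (Quotient.mk s '' C) =
      Prod.fst '' ({p : X × X | s p.1 p.2} ∩ Prod.snd ⁻¹' C) := by
    ext x
    constructor
    · rintro ⟨y, hy, hxy⟩
      exact ⟨(x, y), ⟨s.symm (Quotient.exact hxy), hy⟩, rfl⟩
    · rintro ⟨⟨x, y⟩, ⟨hxy, hy⟩, rfl⟩
      exact ⟨y, hy, (Quotient.sound hxy).symm⟩
  refine isProperMap_iff_isClosedMap_and_compact_fibers.2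
    ⟨continuous_quot_mk, fun C hC ↦ isQuotientMap_quot_mk.isClosed_preimage.1 ?_, fun y ↦ ?_⟩
  · change IsClosed (Quotient.mk s ⁻¹' (Quotient.mk s '' C))
    rw [saturation_eq]
    exact isClosedMap_fst_of_compactSpace _ (hs.inter (hC.preimage continuous_snd))
  · obtain ⟨x, rfl⟩ := Quotient.exists_rep y
    have fiber_eq : Quotient.mk s ⁻¹' {Quotient.mk s x} = (fun z ↦ (z, x)) ⁻¹' {p | s p.1 p.2} :=
      Set.ext fun z ↦ Quotient.eq
    rw [fiber_eq]
    exact (hs.preimage (by fun_prop)).isCompact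

end ProperMaps

namespace IsvtTop

variable {G : Type u} [Group G]

section Adjunction

lemma hom_ext {X Y : IsvtTop G} {f g : X ⟶ Y} (h : ∀ x, f.1 x = g.1 x) : f = g :=
  Subtype.ext (ContinuousMap.ext h)

lemma IsIsovariant.of_smul_eq {X Y : IsvtTop G} {f : C(X.carrier, Y.carrier)}
    (h : ∀ (g : G) (x : X.carrier), f (g • x) = g • f x)
    (h' : ∀ (g : G) (x : X.carrier), g • f x = f x → g • x = x) : IsIsovariant f :=
  ⟨h, fun x ↦ le_antisymm (h' · x) fun g (hg : g • x = x) ↦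
    (h g x).symm.trans (congrArg f hg)⟩

lemma IsIsovariant.smul_eq_iff {X Y : IsvtTop G} {f : C(X.carrier, Y.carrier)}
    (h : IsIsovariant f) (g : G) (x : X.carrier) : g • f x = f x ↔ g • x = x := by
  rw [← MulAction.mem_stabilizer_iff, h.2, MulAction.mem_stabilizer_iff]

/-- Currying: isovariant maps `X × A → Y` are the same as continuous maps `A → Map_isvt(X, Y)`. -/
def prodHomEquiv (X : IsvtTop G) [LocallyCompactSpace X.carrier] (A : TopCat.{u}) (Y : IsvtTop G) :
    (X.prodTop A ⟶ Y) ≃ (A ⟶ X.mapIsvt.obj Y) where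
  toFun f := TopCat.ofHom
    ⟨fun a ↦ ⟨⟨fun x ↦ f.1 (x, a),
        (map_continuous f.1).comp (by fun_prop : Continuous fun x : X.carrier ↦ (x, a))⟩,
      .of_smul_eq (fun g x ↦ f.2.1 g (x, a))
        fun g x h ↦ congrArg Prod.fst ((f.2.smul_eq_iff g (x, a)).1 h)⟩,
      Continuous.subtype_mk (ContinuousMap.curry
        ⟨fun p : A × X.carrier ↦ f.1 (p.2, p.1),
          (map_continuous f.1).comp continuous_swap⟩).continuous _⟩
  invFun φ := ⟨⟨fun p ↦ (φ p.2).1 p.1,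
      (ContinuousMap.continuous_uncurry_of_continuous
        ⟨fun a ↦ (φ a).1, continuous_subtype_val.comp φ.hom.continuous⟩).comp continuous_swap⟩,
    .of_smul_eq (fun g p ↦ (φ p.2).2.1 g p.1) fun g p h ↦
      Prod.ext ((IsIsovariant.smul_eq_iff (φ p.2).2 g p.1).1 h) rfl⟩
  left_inv _ := rfl
  right_inv _ := rfl

lemma isClosed_linkSetoid [TopologicalSpace G] [DiscreteTopology G]
    (H : LTSeries (Subgroup G)) :
    IsClosed {p : (G × stdSimplex ℝ (Fin (H.length + 1))) ×
      (G × stdSimplex ℝ (Fin (H.length + 1))) |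
      linkSetoid H p.1 p.2} := by
  have h : {p : (G × stdSimplex ℝ (Fin (H.length + 1))) × (G × stdSimplex ℝ (Fin (H.length + 1))) |
      linkSetoid H p.1 p.2} = {p | p.1.2 = p.2.2} ∩ ⋃ k : Fin (H.length + 1),
        (⋂ i : Fin (H.length + 1), ⋂ _ : H.length < (i : ℕ) + k, {p | p.1.2.1 i = 0}) ∩
        (fun p ↦ (p.1.1, p.2.1)) ⁻¹' {q : G × G | (q.1 : G ⧸ H k) = (q.2 : G ⧸ H k)} := by
    ext p
    simp only [Set.mem_inter_iff, Set.mem_iUnion, Set.mem_iInter, Set.mem_preimage]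
    rfl
  rw [h]
  refine (isClosed_eq (by fun_prop) (by fun_prop)).inter (isClosed_iUnion_of_finite fun k ↦
    (isClosed_iInter fun i ↦ isClosed_iInter fun _ ↦ isClosed_eq ?_ continuous_const).inter
      ((isClosed_discrete _).preimage (by fun_prop)))
  exact (continuous_apply i).comp (continuous_subtype_val.comp (by fun_prop))

instance [Finite G] (H : LTSeries (Subgroup G)) :
    LocallyCompactSpace (linkingSimplex H).carrier := by
  let _ : TopologicalSpace G := ⊥
  have : DiscreteTopology G := ⟨rfl⟩
  exact locallyCompactSpace_of_isProperMap (isProperMap_quotientMk (isClosed_linkSetoid H))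
    Quotient.exists_rep

/-- The hom-set bijection of `linkAdjunction`. -/
def linkHomEquiv [Finite G] (H : LTSeries (Subgroup G)) (A : TopCat.{u}) :
    ∀ Y : Completed G, ((linkProd H).obj A ⟶ Y) ≃ (A ⟶ (linkMap H).obj Y)
  | .of Y => prodHomEquiv (linkingSimplex H) A Y
  | .star =>
    { toFun _ := TopCat.isTerminalPUnit.from A
      invFun _ := WithTerminal.starTerminal.from _
      left_inv _ := WithTerminal.starTerminal.hom_ext _ _
      right_inv _ := TopCat.isTerminalPUnit.hom_ext _ _ }

/-- The adjunction between `Δ^H_G × -` and `Map_isvt(Δ^H_G, -)`. -/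
def linkAdjunction [Finite G] (H : LTSeries (Subgroup G)) :
    linkProd H ⊣ (linkMap H : Completed G ⥤ TopCat.{u}) :=
  Adjunction.mkOfHomEquiv
    { homEquiv := linkHomEquiv H
      homEquiv_naturality_left_symm := by
        rintro A B (Y | _) f g
        · rfl
        · exact Subsingleton.elim _ _
      homEquiv_naturality_right := by
        rintro A (Y | _) (Z | _) f g
        · rfl
        · exact TopCat.isTerminalPUnit.hom_ext _ _
        · exact g.elim
        · exact TopCat.isTerminalPUnit.hom_ext _ _ }

end Adjunction

section Underlying

variable (G) in
/-- The one-point `G`-space. -/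
def point : IsvtTop G where
  carrier := PUnit

/-- The `G`-space underlying an object of the completed category. The formal terminal object is
sent to the one-point space, which allows all objects to be treated uniformly as sets of points. -/
def underlying : Completed G → IsvtTop G
  | .of X => X
  | .star => point G

/-- The points of an object of the completed category. -/
abbrev Pt (X : Completed G) : Type u := (underlying X).carrier

/-- The map on points of a morphism of the completed category. -/
def underMap : ∀ {X Y : Completed G}, (X ⟶ Y) → C(Pt X, Pt Y)
  | .of _, .of _, f => (WithTerminal.down f).1
  | _, .star, _ => ContinuousMap.const _ PUnit.unit
  | .star, .of _, f => (WithTerminal.false_of_from_star f).elim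

lemma underMap_id (X : Completed G) (x : Pt X) : underMap (𝟙 X) x = x := by
  cases X <;> rfl

lemma underMap_comp {X Y Z : Completed G} (f : X ⟶ Y) (g : Y ⟶ Z) (x : Pt X) :
    underMap (f ≫ g) x = underMap g (underMap f x) := by
  rcases X with X | _ <;> rcases Y with Y | _ <;> rcases Z with Z | _ <;>
    first
    | rfl
    | exact (WithTerminal.false_of_from_star f).elim
    | exact (WithTerminal.false_of_from_star g).elim

lemma of_ne_star (X : IsvtTop G) : (.of X : Completed G) ≠ .star := nofun

lemma ne_star_of_hom {X Y : Completed G} (f : X ⟶ Y) (hY : Y ≠ .star) : X ≠ .star := by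
  rintro rfl
  rcases Y with Y | _
  · exact WithTerminal.false_of_from_star f
  · exact hY rfl

lemma isIsovariant_underMap {X Y : Completed G} (f : X ⟶ Y) (hY : Y ≠ .star) :
    IsIsovariant (underMap f) := by
  rcases X with X | _ <;> rcases Y with Y | _
  · exact (WithTerminal.down f).2
  · exact (hY rfl).elim
  · exact (WithTerminal.false_of_from_star f).elim
  · exact (hY rfl).elim

lemma underMap_smul {X Y : Completed G} (f : X ⟶ Y) (g : G) (x : Pt X) :
    underMap f (g • x) = g • underMap f x := by
  by_cases hY : Y = .star
  · subst hY; rfl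
  · exact (isIsovariant_underMap f hY).1 g x

lemma smul_eq_of_smul_underMap_eq {X Y : Completed G} (f : X ⟶ Y) (hY : Y ≠ .star) {g : G}
    {x : Pt X} (h : g • underMap f x = underMap f x) : g • x = x :=
  ((isIsovariant_underMap f hY).smul_eq_iff g x).1 h

lemma hom_ext_underMap {X Y : Completed G} {f f' : X ⟶ Y}
    (h : ∀ x, underMap f x = underMap f' x) : f = f' := by
  rcases X with X | _ <;> rcases Y with Y | _
  · exact hom_ext (f := WithTerminal.down f) (g := WithTerminal.down f') h
  · exact WithTerminal.starTerminal.hom_ext _ _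
  · exact (WithTerminal.false_of_from_star f).elim
  · exact WithTerminal.starTerminal.hom_ext _ _

/-- The morphism of the completed category with a given map on points. -/
def homMk : ∀ {X Y : Completed G} (φ : C(Pt X, Pt Y))
    (_ : Y ≠ .star → X ≠ .star ∧ IsIsovariant φ), X ⟶ Y
  | .of _, .of _, φ, h => WithTerminal.incl.map ⟨φ, (h (of_ne_star _)).2⟩
  | _, .star, _, _ => WithTerminal.starTerminal.from _
  | .star, .of _, _, h => ((h (of_ne_star _)).1 rfl).elim

@[simp] lemma underMap_homMk {X Y : Completed G} (φ : C(Pt X, Pt Y))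
    (h : Y ≠ .star → X ≠ .star ∧ IsIsovariant φ) (x : Pt X) : underMap (homMk φ h) x = φ x := by
  rcases X with X | _ <;> rcases Y with Y | _
  · rfl
  · rfl
  · exact ((h (of_ne_star _)).1 rfl).elim
  · rfl

lemma hom_ext_of_eq_star {X Y : Completed G} (h : Y = .star) (f f' : X ⟶ Y) : f = f' := by
  subst h
  exact WithTerminal.starTerminal.hom_ext _ _

end Underlying

section Limits

variable {J : Type u} [Category.{u} J] (F : J ⥤ Completed G)

/-- The points of the limit of a diagram of `G`-spaces: the compatible families of points which all
have the same isotropy group. Objects equal to the formal terminal object impose no condition. -/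
def LimitPt : Type u :=
  {x : ∀ j, Pt (F.obj j) // (∀ ⦃j k⦄ (f : j ⟶ k), underMap (F.map f) (x j) = x k) ∧
    ∀ (j k) (g : G), F.obj j ≠ .star → g • x j = x j → g • x k = x k}

instance : TopologicalSpace (LimitPt F) := inferInstanceAs (TopologicalSpace (Subtype _))

instance : MulAction G (LimitPt F) where
  smul g x := ⟨fun j ↦ g • x.1 j, fun j k f ↦ by rw [underMap_smul, x.2.1], fun j k h hj hg ↦ by
    have := x.2.2 j k (g⁻¹ * h * g) hj (by rw [mul_smul, mul_smul, hg, inv_smul_smul])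
    rwa [mul_smul, mul_smul, inv_smul_eq_iff] at this⟩
  one_smul x := Subtype.ext (funext fun j ↦ one_smul G _)
  mul_smul g h x := Subtype.ext (funext fun j ↦ mul_smul g h _)

instance : ContinuousConstSMul G (LimitPt F) where
  continuous_const_smul g := Continuous.subtype_mk (continuous_pi fun j ↦
    ((continuous_apply j).comp continuous_subtype_val).const_smul g) _

/-- The limit of a diagram in the completed category which has an object different from the formal
terminal object. -/
def limitSpace : IsvtTop G where
  carrier := LimitPt F

/-- The projections from `limitSpace`. -/
def limitπ (j : J) : (.of (limitSpace F) : Completed G) ⟶ F.obj j :=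
  homMk ⟨fun x : LimitPt F ↦ x.1 j, (continuous_apply j).comp continuous_subtype_val⟩
    fun hj ↦ ⟨of_ne_star _, .of_smul_eq (fun _ _ ↦ rfl) fun g (x : LimitPt F) hx ↦
      Subtype.ext (funext fun k ↦ x.2.2 j k g hj hx)⟩

lemma underMap_limitπ (j : J) (x : LimitPt F) : underMap (limitπ F j) x = x.1 j :=
  underMap_homMk (X := .of (limitSpace F)) _ _ _

/-- The cone with point `limitSpace F`. -/
def limitCone : Cone F where
  pt := .of (limitSpace F)
  π :=
    { app := limitπ F
      naturality j k f := hom_ext_underMap fun x : LimitPt F ↦ by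
        calc underMap (𝟙 _ ≫ limitπ F k) x = x.1 k := by rw [Category.id_comp, underMap_limitπ]
          _ = underMap (F.map f) (x.1 j) := (x.2.1 f).symm
          _ = underMap (limitπ F j ≫ F.map f) x := by
            rw [← underMap_limitπ]; exact (underMap_comp _ _ _).symm }

variable {F}

/-- The map to `limitSpace F` induced by a cone. -/
def limitLift (s : Cone F) : C(Pt s.pt, LimitPt F) :=
  ⟨fun x ↦ ⟨fun j ↦ underMap (s.π.app j) x, fun j k f ↦ by rw [← underMap_comp, s.w],
      fun j k g hj h ↦ by rw [← underMap_smul, smul_eq_of_smul_underMap_eq _ hj h]⟩,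
    Continuous.subtype_mk (continuous_pi fun j ↦ (underMap (s.π.app j)).continuous) _⟩

/-- `limitCone F` is a limit cone as soon as `F` has a value which is not the formal terminal
object. -/
def isLimitLimitCone {j₀ : J} (h₀ : F.obj j₀ ≠ .star) : IsLimit (limitCone F) where
  lift s := homMk (Y := .of (limitSpace F)) (limitLift s)
    fun _ ↦ ⟨ne_star_of_hom (s.π.app j₀) h₀, .of_smul_eq
      (fun g x ↦ Subtype.ext (funext fun j ↦ underMap_smul _ _ _))
      fun g x h ↦ smul_eq_of_smul_underMap_eq (s.π.app j₀) h₀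
        (congr_fun (congrArg Subtype.val h) j₀)⟩
  fac s j := hom_ext_underMap fun x ↦ by
    refine (underMap_comp _ _ _).trans ((underMap_limitπ F j _).trans ?_)
    exact congrArg (fun y : LimitPt F ↦ y.1 j)
      (underMap_homMk (Y := .of (limitSpace F)) (limitLift s) _ x)
  uniq s m hm := hom_ext_underMap fun x ↦ by
    refine Eq.trans ?_ (underMap_homMk (Y := .of (limitSpace F)) (limitLift s) _ x).symm
    refine Subtype.ext (funext fun j ↦ ?_)
    refine Eq.trans ?_ (congrArg (underMap · x) (hm j))
    exact ((underMap_comp _ _ _).trans (underMap_limitπ F j _)).symm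

instance : HasLimits (Completed G) where
  has_limits_of_shape J _ :=
    { has_limit F := by
        by_cases h : ∃ j, F.obj j ≠ .star
        · obtain ⟨j, hj⟩ := h
          exact ⟨⟨⟨_, isLimitLimitCone hj⟩⟩⟩
        · push Not at h
          exact ⟨⟨⟨{ pt := .star
                     π := { app j := eqToHom (h j).symm
                            naturality _ _ _ := hom_ext_of_eq_star (h _) _ _ } },
            { lift s := WithTerminal.starTerminal.from _
              fac _ j := hom_ext_of_eq_star (h j) _ _
              uniq _ _ _ := WithTerminal.starTerminal.hom_ext _ _ }⟩⟩⟩ }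

end Limits

section Colimits

variable {J : Type u} [Category.{u} J] (F : J ⥤ Completed G)

/-- The relation on the disjoint union of the spaces of a diagram which generates the equivalence
relation defining the colimit. -/
def ColimitRel (p q : Σ j, Pt (F.obj j)) : Prop :=
  ∃ f : p.1 ⟶ q.1, underMap (F.map f) p.2 = q.2

/-- The colimit of the spaces underlying a diagram in the completed category. -/
def ColimitPt : Type u := Quot (ColimitRel F)

instance : TopologicalSpace (ColimitPt F) := inferInstanceAs (TopologicalSpace (Quot _))

instance : MulAction G (ColimitPt F) where
  smul g := Quot.map (fun p ↦ ⟨p.1, g • p.2⟩) (fun p q ⟨f, hf⟩ ↦ ⟨f, by rw [underMap_smul, hf]⟩)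
  one_smul := by
    rintro ⟨j, x⟩
    exact congrArg (fun y ↦ Quot.mk (ColimitRel F) ⟨j, y⟩) (one_smul G x)
  mul_smul g h := by
    rintro ⟨j, x⟩
    exact congrArg (fun y ↦ Quot.mk (ColimitRel F) ⟨j, y⟩) (mul_smul g h x)

instance : ContinuousConstSMul G (ColimitPt F) where
  continuous_const_smul g := continuous_quot_lift _ (continuous_quot_mk.comp
    (continuous_sigma fun _ ↦ continuous_sigmaMk.comp (continuous_const_smul g)))

/-- The colimit of the `G`-spaces underlying a diagram in the completed category. -/
def colimitSpace : IsvtTop G where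
  carrier := ColimitPt F

/-- The inclusion of a space of the diagram in the colimit. -/
def colimitι (j : J) : C(Pt (F.obj j), ColimitPt F) :=
  ⟨fun x ↦ Quot.mk _ ⟨j, x⟩, continuous_quot_mk.comp continuous_sigmaMk⟩

/-- The condition that the inclusions `colimitι F j` are isovariant maps of `G`-spaces; otherwise
the colimit of `F` is the formal terminal object. -/
def HasIsovariantColimit : Prop :=
  ∀ j, F.obj j ≠ .star ∧
    ∀ (g : G) (x : Pt (F.obj j)), g • colimitι F j x = colimitι F j x → g • x = x

variable {F}

/-- The map from the colimit induced by a cocone. -/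
def colimitDesc (s : Cocone F) : C(ColimitPt F, Pt s.pt) :=
  ⟨Quot.lift (fun p ↦ underMap (s.ι.app p.1) p.2) (by
    rintro p q ⟨f, hf⟩
    rw [← hf, ← underMap_comp, s.w]), continuous_quot_lift _
      (continuous_sigma fun j ↦ (underMap (s.ι.app j)).continuous)⟩

lemma colimitDesc_smul (s : Cocone F) (g : G) (z : ColimitPt F) :
    colimitDesc s (g • z) = g • colimitDesc s z := by
  obtain ⟨j, x⟩ := z
  exact underMap_smul (s.ι.app j) g x

/-- The morphism of the completed category given by `colimitι F j`. -/
def colimitιHom (h : HasIsovariantColimit F) (j : J) :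
    F.obj j ⟶ (.of (colimitSpace F) : Completed G) :=
  homMk (colimitι F j) fun _ ↦ ⟨(h j).1, .of_smul_eq (fun _ _ ↦ rfl) (h j).2⟩

lemma underMap_colimitιHom (h : HasIsovariantColimit F) (j : J) (x : Pt (F.obj j)) :
    underMap (colimitιHom h j) x = colimitι F j x :=
  underMap_homMk (Y := .of (colimitSpace F)) _ _ _

/-- The cocone with point `colimitSpace F`. -/
def colimitCocone (h : HasIsovariantColimit F) : Cocone F where
  pt := .of (colimitSpace F)
  ι :=
    { app := colimitιHom h
      naturality j k f := hom_ext_underMap fun x ↦ by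
        refine ((underMap_comp _ _ _).trans (underMap_colimitιHom h k _)).trans ?_
        refine Eq.trans ?_ ((underMap_comp _ _ _).trans (underMap_id _ _)).symm
        exact Eq.trans (Quot.sound ⟨f, rfl⟩ : colimitι F j x = colimitι F k _).symm
          (underMap_colimitιHom h j x).symm }

/-- `colimitCocone h` is a colimit cocone. -/
def isColimitColimitCocone (h : HasIsovariantColimit F) : IsColimit (colimitCocone h) where
  desc s := homMk (X := .of (colimitSpace F)) (colimitDesc s) fun hs ↦ ⟨of_ne_star _, .of_smul_eq
    (colimitDesc_smul s) (by
      rintro g ⟨j, x⟩ hx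
      exact congrArg (colimitι F j) (smul_eq_of_smul_underMap_eq (s.ι.app j) hs hx))⟩
  fac s j := hom_ext_underMap fun x ↦ by
    refine (underMap_comp _ _ _).trans ?_
    refine (underMap_homMk (X := .of (colimitSpace F)) (colimitDesc s) _ _).trans ?_
    exact congrArg (colimitDesc s) (underMap_colimitιHom h j x)
  uniq s m hm := hom_ext_underMap (X := .of (colimitSpace F)) (by
    rintro ⟨j, x⟩
    refine Eq.trans ?_ (underMap_homMk (X := .of (colimitSpace F)) (colimitDesc s) _ _).symm
    refine Eq.trans ?_ (congrArg (underMap · x) (hm j))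
    exact ((underMap_comp _ _ _).trans
      (congrArg (underMap m) (underMap_colimitιHom h j x))).symm)

lemma HasIsovariantColimit.of_cocone (s : Cocone F) (hs : s.pt ≠ .star) :
    HasIsovariantColimit F := fun j ↦
  ⟨ne_star_of_hom (s.ι.app j) hs, fun g x hx ↦ smul_eq_of_smul_underMap_eq (s.ι.app j) hs <|
    (colimitDesc_smul s g (colimitι F j x)).symm.trans (congrArg (colimitDesc s) hx)⟩

instance : HasColimits (Completed G) where
  has_colimits_of_shape J _ :=
    { has_colimit F := by
        by_cases h : HasIsovariantColimit F
        · exact ⟨⟨⟨_, isColimitColimitCocone h⟩⟩⟩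
        · have hs (s : Cocone F) : s.pt = .star := by
            by_contra hs
            exact h (.of_cocone s hs)
          exact ⟨⟨⟨{ pt := .star
                     ι := { app j := WithTerminal.starTerminal.from _
                            naturality _ _ _ := WithTerminal.starTerminal.hom_ext _ _ } },
            { desc s := eqToHom (hs s).symm
              fac s j := hom_ext_of_eq_star (hs s) _ _
              uniq s _ _ := hom_ext_of_eq_star (hs s) _ _ }⟩⟩⟩ }

end Colimits

/-! ### Smallness -/

section Cofree

/-- The points of `cofreeSpace Y S`: the pairs of a point `y : Y` and of a map `G → S` which is
fixed by the isotropy group of `y`. -/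
def CofreePt (Y : IsvtTop G) (S : Type) : Type u :=
  {p : Y.carrier × (G → S) // ∀ g : G, g • p.1 = p.1 → ∀ h : G, p.2 (h * g) = p.2 h}

variable (Y : IsvtTop G) (S : Type) [TopologicalSpace S]

instance : TopologicalSpace (CofreePt Y S) := inferInstanceAs (TopologicalSpace (Subtype _))

instance : MulAction G (CofreePt Y S) where
  smul g p := ⟨(g • p.1.1, fun h ↦ p.1.2 (h * g)), fun k hk h ↦ by
    have := p.2 (g⁻¹ * k * g) (by
      change k • g • p.1.1 = g • p.1.1 at hk
      rw [mul_smul, mul_smul, hk, inv_smul_smul]) (h * g)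
    simpa [mul_assoc] using this⟩
  one_smul p := Subtype.ext (Prod.ext (one_smul G p.1.1)
    (funext fun h ↦ congrArg p.1.2 (mul_one h)))
  mul_smul g k p := Subtype.ext (Prod.ext (mul_smul g k p.1.1)
    (funext fun h ↦ congrArg p.1.2 (mul_assoc h g k).symm))

instance : ContinuousConstSMul G (CofreePt Y S) where
  continuous_const_smul g := by
    have h₁ : Continuous fun p : CofreePt Y S ↦ p.1 := continuous_subtype_val
    exact Continuous.subtype_mk (Continuous.prodMk ((continuous_fst.comp h₁).const_smul g)
      (continuous_pi fun h ↦ (continuous_apply (h * g)).comp (continuous_snd.comp h₁))) _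

/-- The cofree `G`-space over `Y` on a space `S`: an isovariant map to it is an isovariant map to
`Y` together with a mere continuous map to `S`. -/
def cofreeSpace : IsvtTop G where
  carrier := CofreePt Y S

/-- The projection `cofreeSpace Y S ⟶ Y`. -/
def cofreeπ : (.of (cofreeSpace Y S) : Completed G) ⟶ .of Y :=
  WithTerminal.incl.map ⟨⟨fun p : CofreePt Y S ↦ p.1.1,
    continuous_fst.comp continuous_subtype_val⟩,
    .of_smul_eq (fun _ _ ↦ rfl) fun g (p : CofreePt Y S) hp ↦
      Subtype.ext (Prod.ext hp (funext fun h ↦ p.2 g hp h))⟩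

/-- The universal (non-equivariant) map `cofreeSpace Y S → S`. -/
def cofreeEval : C(CofreePt Y S, S) :=
  ⟨fun p ↦ p.1.2 1, (continuous_apply _).comp (continuous_snd.comp continuous_subtype_val)⟩

variable {Y S} {A : Completed G}

/-- The map of spaces underlying `cofreeLift`. -/
def cofreeLiftMap (t : A ⟶ .of Y) (u : C(Pt A, S)) : C(Pt A, CofreePt Y S) :=
  ⟨fun a ↦ ⟨(underMap t a, fun g ↦ u (g • a)), fun g hg k ↦ congrArg u <|
      (mul_smul k g a).trans
        (congrArg (k • ·) (smul_eq_of_smul_underMap_eq t (of_ne_star Y) hg))⟩,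
    Continuous.subtype_mk ((underMap t).continuous.prodMk
      (continuous_pi fun g ↦ u.continuous.comp (continuous_const_smul g))) _⟩

/-- The morphism to `cofreeSpace Y S` with given components. -/
def cofreeLift (t : A ⟶ .of Y) (u : C(Pt A, S)) : A ⟶ .of (cofreeSpace Y S) :=
  homMk (Y := .of (cofreeSpace Y S)) (cofreeLiftMap t u) fun _ ↦
    ⟨ne_star_of_hom t (of_ne_star Y), .of_smul_eq
      (fun g a ↦ Subtype.ext (Prod.ext (underMap_smul t g a)
        (funext fun k ↦ congrArg u (mul_smul k g a).symm)))
      fun _ _ h ↦ smul_eq_of_smul_underMap_eq t (of_ne_star Y)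
        (congrArg (fun p : CofreePt Y S ↦ p.1.1) h)⟩

lemma underMap_cofreeLift (t : A ⟶ .of Y) (u : C(Pt A, S)) (a : Pt A) :
    underMap (cofreeLift t u) a = cofreeLiftMap t u a :=
  underMap_homMk (Y := .of (cofreeSpace Y S)) _ _ a

lemma cofreeLift_comp_cofreeπ (t : A ⟶ .of Y) (u : C(Pt A, S)) :
    cofreeLift t u ≫ cofreeπ Y S = t :=
  hom_ext_underMap fun a ↦ (underMap_comp _ _ _).trans
    (congrArg (fun p : CofreePt Y S ↦ p.1.1) (underMap_cofreeLift t u a))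

lemma cofreeEval_cofreeLift (t : A ⟶ .of Y) (u : C(Pt A, S)) (a : Pt A) :
    cofreeEval Y S (underMap (cofreeLift t u) a) = u a :=
  (congrArg (cofreeEval Y S) (underMap_cofreeLift t u a)).trans (congrArg u (one_smul G a))

lemma cofree_hom_ext {s s' : A ⟶ .of (cofreeSpace Y S)}
    (h : s ≫ cofreeπ Y S = s' ≫ cofreeπ Y S)
    (h' : ∀ a, cofreeEval Y S (underMap s a) = cofreeEval Y S (underMap s' a)) : s = s' := by
  refine hom_ext_underMap fun a ↦ Subtype.ext (Prod.ext ?_ (funext fun g ↦ ?_))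
  · exact (underMap_comp s _ a).symm.trans
      ((congrArg (underMap · a) h).trans (underMap_comp s' _ a))
  · have eval_smul (r : A ⟶ .of (cofreeSpace Y S)) :
        cofreeEval Y S (underMap r (g • a)) = (underMap r a : CofreePt Y S).1.2 g :=
      (congrArg (cofreeEval Y S) (underMap_smul r g a)).trans
        (congrArg (underMap r a : CofreePt Y S).1.2 (one_mul g))
    rw [← eval_smul, ← eval_smul, h']

lemma hasLiftingProperty_cofreeπ {B : Completed G} {f : A ⟶ B}
    (h : ∀ u : C(Pt A, S), ∃ v : C(Pt B, S), ∀ a, v (underMap f a) = u a) :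
    HasLiftingProperty f (cofreeπ Y S) where
  sq_hasLift {s t} sq := by
    obtain ⟨v, hv⟩ := h ((cofreeEval Y S).comp (underMap s))
    refine ⟨⟨⟨cofreeLift t v, cofree_hom_ext ?_ fun a ↦ ?_, cofreeLift_comp_cofreeπ t v⟩⟩⟩
    · rw [Category.assoc, cofreeLift_comp_cofreeπ, sq.w]
    · rw [underMap_comp, cofreeEval_cofreeLift, hv]
      rfl

lemma exists_extension_of_hasLiftingProperty (f : A ⟶ .of Y)
    [HasLiftingProperty f (cofreeπ Y S)] (u : C(Pt A, S)) :
    ∃ v : C(Y.carrier, S), ∀ a, v (underMap f a) = u a := by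
  have sq : CommSq (cofreeLift f u) f (cofreeπ Y S) (𝟙 _) :=
    ⟨(cofreeLift_comp_cofreeπ f u).trans (Category.comp_id f).symm⟩
  refine ⟨(cofreeEval Y S).comp (underMap sq.lift), fun a ↦ ?_⟩
  calc cofreeEval Y S (underMap sq.lift (underMap f a))
      = cofreeEval Y S (underMap (f ≫ sq.lift) a) := by rw [underMap_comp]
    _ = u a := by rw [sq.fac_left, cofreeEval_cofreeLift]

end Cofree

section SetSpace

variable (G) in
/-- The set of subsets of `G`, with the indiscrete topology and the action by left
multiplication. Every subgroup is the isotropy group of a point, so it receives an isovariant map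
from every `G`-space. -/
def setSpace : IsvtTop G :=
  letI : TopologicalSpace (Set G) := ⊤
  letI : MulAction G (Set G) := Set.mulActionSet
  { carrier := Set G
    cont := ⟨fun _ ↦ continuous_top⟩ }

/-- The set of all `g` such that `g • x = y`. -/
def transporter {X : IsvtTop G} (x y : X.carrier) : (setSpace G).carrier :=
  {g : G | g • x = y}

lemma smul_transporter {X : IsvtTop G} (x y : X.carrier) (g : G) :
    g • transporter x y = transporter x (g • y) :=
  Set.ext fun h ↦ Set.mem_smul_set_iff_inv_smul_mem.trans <| by
    change (g⁻¹ * h) • x = y ↔ h • x = g • y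
    rw [mul_smul, inv_smul_eq_iff]

lemma eq_of_transporter_eq {X : IsvtTop G} {x y z : X.carrier} (h : ∃ g : G, g • x = y)
    (h' : transporter x y = transporter x z) : y = z := by
  obtain ⟨g, hg⟩ := h
  exact hg.symm.trans ((Set.ext_iff.1 h' g).1 hg)

lemma continuous_setSpace {X : Type*} [TopologicalSpace X] (f : X → (setSpace G).carrier) :
    Continuous f :=
  continuous_top

lemma exists_isIsovariant_setSpace (B : IsvtTop G) :
    ∃ v : C(B.carrier, (setSpace G).carrier), IsIsovariant v := by
  let o : Setoid B.carrier := MulAction.orbitRel G B.carrier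
  let r (b : B.carrier) : B.carrier := (Quotient.mk o b).out
  have mem_orbit_r (b : B.carrier) : ∃ g : G, g • r b = b :=
    MulAction.orbitRel_apply.1 (Setoid.symm (Quotient.mk_out b))
  have r_smul (g : G) (b : B.carrier) : r (g • b) = r b :=
    congrArg Quotient.out (Quotient.sound (MulAction.orbitRel_apply.2 ⟨g, rfl⟩))
  refine ⟨⟨fun b ↦ transporter (r b) b, continuous_setSpace _⟩, .of_smul_eq (fun g b ↦ ?_)
    fun g b hb ↦ ?_⟩
  · change transporter (r (g • b)) (g • b) = g • transporter (r b) b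
    rw [smul_transporter, r_smul]
  · exact (eq_of_transporter_eq (mem_orbit_r b) (hb.symm.trans (smul_transporter _ _ g))).symm

lemma exists_extension_setSpace {A B : IsvtTop G} (f : C(A.carrier, B.carrier))
    (hf : IsIsovariant f) (hf' : Function.Injective f) (u : C(A.carrier, (setSpace G).carrier))
    (hu : IsIsovariant u) :
    ∃ v : C(B.carrier, (setSpace G).carrier), IsIsovariant v ∧ ∀ a, v (f a) = u a := by
  obtain ⟨v₀, hv₀⟩ := exists_isIsovariant_setSpace B
  let v : B.carrier → (setSpace G).carrier := Function.extend f u v₀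
  have v_apply (a : A.carrier) : v (f a) = u a := hf'.extend_apply u v₀ a
  have v_apply' (b : B.carrier) (h : ¬ ∃ a, f a = b) : v b = v₀ b :=
    Function.extend_apply' u v₀ b h
  refine ⟨⟨v, continuous_setSpace v⟩, .of_smul_eq (fun g b ↦ ?_) (fun g b hb ↦ ?_), v_apply⟩
  · change v (g • b) = g • v b
    by_cases h : ∃ a, f a = b
    · obtain ⟨a, rfl⟩ := h
      rw [← hf.1, v_apply, v_apply, hu.1]
    · have h' : ¬ ∃ a, f a = g • b := fun ⟨a, ha⟩ ↦
        h ⟨g⁻¹ • a, by rw [hf.1, ha, inv_smul_smul]⟩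
      rw [v_apply' b h, v_apply' _ h', hv₀.1]
  · change g • v b = v b at hb
    by_cases h : ∃ a, f a = b
    · obtain ⟨a, rfl⟩ := h
      rw [v_apply] at hb
      rw [← hf.1, (hu.smul_eq_iff g a).1 hb]
    · rw [v_apply' b h] at hb
      exact (hv₀.smul_eq_iff g b).1 hb

end SetSpace

section EmbeddingTests

/-- The two-point space with the indiscrete topology, as opposed to the Sierpiński space `Prop`. -/
def IndiscreteProp : Type := Prop

instance : TopologicalSpace IndiscreteProp := ⊤

variable (G) in
/-- The left lifting property against these morphisms forces a morphism to be an embedding: the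
cofree spaces on `Prop` test for the induced topology, those on `IndiscreteProp` for injectivity,
and `setSpace G` for morphisms from a `G`-space to the formal terminal object. -/
def embeddingTests : MorphismProperty (Completed G) :=
  MorphismProperty.ofHoms (fun Y : IsvtTop G ↦ cofreeπ Y Prop) ⊔
    MorphismProperty.ofHoms (fun Y : IsvtTop G ↦ cofreeπ Y IndiscreteProp) ⊔
      MorphismProperty.ofHoms (fun _ : Unit ↦
        WithTerminal.starTerminal.from (.of (setSpace G) : Completed G))

variable {A B : Completed G} {f : A ⟶ B}

lemma ne_star_of_llp_embeddingTests (hf : (embeddingTests G).llp f) (hA : A ≠ .star) :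
    B ≠ .star := by
  rintro rfl
  have := hf _ (.inr ⟨()⟩)
  obtain ⟨v, hv⟩ := exists_isIsovariant_setSpace (underlying A)
  have sq : CommSq (homMk (Y := .of (setSpace G)) v fun _ ↦ ⟨hA, hv⟩) f
    (WithTerminal.starTerminal.from (.of (setSpace G) : Completed G)) (𝟙 _) :=
      ⟨WithTerminal.starTerminal.hom_ext _ _⟩
  exact WithTerminal.false_of_from_star sq.lift

lemma isEmbedding_of_llp_embeddingTests (hf : (embeddingTests G).llp f) (hB : B ≠ .star) :
    Topology.IsEmbedding (underMap f) := by
  rcases B with Y | _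
  · have := hf _ (.inl (.inl ⟨Y⟩))
    have := hf _ (.inl (.inr ⟨Y⟩))
    refine ⟨⟨le_antisymm (underMap f).continuous.le_induced fun U hU ↦ ?_⟩, fun a a' h ↦ ?_⟩
    · obtain ⟨v, hv⟩ := exists_extension_of_hasLiftingProperty (S := Prop) f
        ⟨(· ∈ U), continuous_Prop.2 hU⟩
      exact ⟨{y | v y}, continuous_Prop.1 v.continuous, Set.ext fun a ↦ iff_of_eq (hv a)⟩
    · obtain ⟨v, hv⟩ := exists_extension_of_hasLiftingProperty (S := IndiscreteProp) f
        ⟨fun x ↦ (x = a : Prop), continuous_top⟩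
      have : (a' = a) = (a = a) := (hv a').symm.trans ((congrArg v h.symm).trans (hv a))
      exact (this.mpr rfl).symm
  · exact (hB rfl).elim

lemma llp_embeddingTests_of_isEmbedding (hB : B ≠ .star)
    (hf : Topology.IsEmbedding (underMap f)) : (embeddingTests G).llp f := by
  rintro _ _ _ ((⟨⟨Y⟩⟩ | ⟨⟨Y⟩⟩) | ⟨⟨⟩⟩)
  · refine hasLiftingProperty_cofreeπ fun u ↦ ?_
    obtain ⟨V, hV, hV'⟩ := hf.isInducing.isOpen_iff.1 (continuous_Prop.1 u.continuous)
    exact ⟨⟨fun b ↦ b ∈ V, continuous_Prop.2 hV⟩, fun a ↦ congrArg (a ∈ ·) hV'⟩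
  · refine hasLiftingProperty_cofreeπ fun u ↦ ?_
    refine ⟨⟨fun b ↦ (∃ a, underMap f a = b ∧ u a : Prop), continuous_top⟩, fun a ↦
      propext ⟨fun ⟨a', h, h'⟩ ↦ ?_, fun h ↦ ⟨a, rfl, h⟩⟩⟩
    rwa [← hf.injective h]
  · constructor
    intro s t sq
    obtain ⟨v, hv, hv'⟩ := exists_extension_setSpace (underMap f) (isIsovariant_underMap f hB)
      hf.injective (underMap s) (isIsovariant_underMap s (of_ne_star _))
    refine ⟨⟨⟨homMk (Y := .of (setSpace G)) v fun _ ↦ ⟨hB, hv⟩, ?_,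
      WithTerminal.starTerminal.hom_ext _ _⟩⟩⟩
    refine hom_ext_underMap fun a ↦ (underMap_comp _ _ _).trans ?_
    exact (underMap_homMk (Y := .of (setSpace G)) _ _ _).trans (hv' a)

lemma mono_of_llp_embeddingTests (hf : (embeddingTests G).llp f) : Mono f where
  right_cancellation {Z} x y h := by
    by_cases hB : B = .star
    · refine hom_ext_of_eq_star ?_ x y
      by_contra hA
      exact ne_star_of_llp_embeddingTests hf hA hB
    · refine hom_ext_underMap fun a ↦ (isEmbedding_of_llp_embeddingTests hf hB).injective ?_
      rw [← underMap_comp, ← underMap_comp, h]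

lemma llp_embeddingTests_linkProd_map (H : LTSeries (Subgroup G)) {A B : TopCat.{u}} {i : A ⟶ B}
    (hi : Topology.IsEmbedding i) : (embeddingTests G).llp ((linkProd H).map i) :=
  llp_embeddingTests_of_isEmbedding (of_ne_star _)
    (Topology.IsEmbedding.id.prodMap hi :
      Topology.IsEmbedding (Prod.map (id : LinkingSimplex H → LinkingSimplex H) i))

lemma generatingCofibrations_le_llp_embeddingTests :
    generatingCofibrations G ≤ (embeddingTests G).llp := by
  rintro _ _ _ ⟨p⟩
  exact llp_embeddingTests_linkProd_map _ (isEmbedding_diskBoundaryInclusion _)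

lemma generatingAcyclicCofibrations_le_llp_embeddingTests :
    generatingAcyclicCofibrations G ≤ (embeddingTests G).llp := by
  rintro _ _ _ ⟨p⟩
  exact llp_embeddingTests_linkProd_map _ (isEmbedding_diskCylinderInclusion _)

end EmbeddingTests

section Smallness

lemma exists_of_isColimit {J : Type u} [Category.{u} J] {F : J ⥤ Completed G} {t : Cocone F}
    (ht : IsColimit t) (h : t.pt ≠ .star) (p : Pt t.pt) : ∃ j x, underMap (t.ι.app j) x = p := by
  have hF : HasIsovariantColimit F := .of_cocone t h
  let e := ht.coconePointUniqueUpToIso (isColimitColimitCocone hF)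
  obtain ⟨⟨j, x⟩, hx⟩ := Quot.exists_rep (underMap e.hom p : ColimitPt F)
  refine ⟨j, x, ?_⟩
  calc underMap (t.ι.app j) x
      = underMap ((colimitCocone hF).ι.app j ≫ e.inv) x := by
        rw [ht.comp_coconePointUniqueUpToIso_inv (isColimitColimitCocone hF) j]
    _ = underMap e.inv (underMap e.hom p) := by
        rw [underMap_comp]
        exact congrArg (underMap e.inv) ((underMap_colimitιHom hF j x).trans hx)
    _ = p := by rw [← underMap_comp, e.hom_inv_id, underMap_id]

lemma exists_lift_of_isEmbedding {A B C : Completed G} (m : B ⟶ C) (hC : C ≠ .star)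
    (hm : Topology.IsEmbedding (underMap m)) (φ : A ⟶ C)
    (h : ∀ a, ∃ b, underMap m b = underMap φ a) : ∃ ψ : A ⟶ B, ψ ≫ m = φ := by
  choose y hy using h
  have continuous_y : Continuous y := by
    rw [hm.continuous_iff]
    exact (underMap φ).continuous.congr fun a ↦ (hy a).symm
  have y_smul (g : G) (a : Pt A) : y (g • a) = g • y a := hm.injective <| by
    rw [underMap_smul, hy, hy, underMap_smul]
  refine ⟨homMk ⟨y, continuous_y⟩ fun _ ↦ ⟨ne_star_of_hom φ hC, .of_smul_eq y_smul
    fun g a (h : g • y a = y a) ↦ ?_⟩, hom_ext_underMap fun a ↦ ?_⟩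
  · refine smul_eq_of_smul_underMap_eq φ hC ?_
    rw [← hy, ← underMap_smul, h]
  · rw [underMap_comp, underMap_homMk]
    exact hy a

lemma preservesColimit_coyoneda {A : Completed G} {κ : Cardinal.{u}} [Fact κ.IsRegular]
    (hA : HasCardinalLT (Pt A) κ) {J : Type u} [LinearOrder J] [SuccOrder J] [OrderBot J]
    [WellFoundedLT J] [IsCardinalFiltered J κ] (F : J ⥤ Completed G) [F.IsWellOrderContinuous]
    (hF : ∀ j : J, ¬ IsMax j → (embeddingTests G).llp (F.map (homOfLE (Order.le_succ j)))) :
    PreservesColimit F (coyoneda.obj (Opposite.op A)) where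
  preserves {t} ht := by
    have := isFiltered_of_isCardinalFiltered J κ
    let c : (embeddingTests G).llp.TransfiniteCompositionOfShape J (t.ι.app ⊥) :=
      { F := F
        isoBot := Iso.refl _
        incl := t.ι
        isColimit := ht
        fac := Category.id_comp _
        map_mem := hF }
    have hι (j : J) : (embeddingTests G).llp (t.ι.app j) := c.mem_incl_app j
    have exists_factorization (φ : A ⟶ t.pt) :
        ∃ (k : J) (ψ : A ⟶ F.obj k), ψ ≫ t.ι.app k = φ := by
      by_cases hpt : t.pt = .star
      · have h : F.obj ⊥ = .star := by
          by_contra h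
          exact ne_star_of_llp_embeddingTests (hι ⊥) h hpt
        exact ⟨⊥, WithTerminal.starTerminal.from A ≫ eqToHom h.symm, hom_ext_of_eq_star hpt _ _⟩
      · choose j x hx using fun a ↦ exists_of_isColimit ht hpt (underMap φ a)
        refine ⟨IsCardinalFiltered.max j hA, exists_lift_of_isEmbedding _ hpt
          (isEmbedding_of_llp_embeddingTests (hι _) hpt) φ fun a ↦
            ⟨underMap (F.map (IsCardinalFiltered.toMax j hA a)) (x a), ?_⟩⟩
        rw [← underMap_comp, t.w, hx]
    refine ⟨Types.FilteredColimit.isColimitOf' _ _ (fun (φ : A ⟶ t.pt) ↦ ?_)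
      fun j (x : A ⟶ F.obj j) (y : A ⟶ F.obj j) (h : x ≫ t.ι.app j = y ≫ t.ι.app j) ↦
        ⟨j, 𝟙 j, congrArg (fun f : A ⟶ F.obj j ↦ f ≫ F.map (𝟙 j)) ?_⟩⟩
    · obtain ⟨k, ψ, hψ⟩ := exists_factorization φ
      exact ⟨k, ψ, hψ.symm⟩
    · have := mono_of_llp_embeddingTests (hι j)
      exact (cancel_mono (t.ι.app j)).1 h

lemma hasCardinalLT_succ {T : Type u} {c : Cardinal.{u}} (h : Cardinal.mk T ≤ c) :
    HasCardinalLT T (Order.succ c) := by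
  rw [hasCardinalLT_iff_cardinal_mk_lt]
  exact Order.lt_succ_of_le h

lemma isSmallRelativeTo_relativeCells {I : MorphismProperty (Completed G)}
    (hI : I ≤ (embeddingTests G).llp) (A : Completed G) :
    IsSmallRelativeTo A (relativeCells I) := by
  let c : Cardinal.{u} := max Cardinal.aleph0 (Cardinal.mk (Pt A))
  have : Fact (Order.succ c).IsRegular := ⟨Cardinal.isRegular_succ (le_max_left _ _)⟩
  have hA : HasCardinalLT (Pt A) (Order.succ c) := hasCardinalLT_succ (le_max_right _ _)
  have relativeCells_le : relativeCells I ≤ (embeddingTests G).llp := by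
    rw [relativeCells, MorphismProperty.transfiniteCompositions_le_iff]
    exact (MorphismProperty.pushouts_monotone hI).trans MorphismProperty.pushouts_le
  exact ⟨_, this, fun J _ _ _ _ _ _ F _ hF ↦
    preservesColimit_coyoneda hA F fun j _ ↦ relativeCells_le _ (hF j)⟩

lemma hasSmallObjectArgument_of_le_llp_embeddingTests {I : MorphismProperty (Completed G)}
    [MorphismProperty.IsSmall.{u} I] (hI : I ≤ (embeddingTests G).llp) :
    MorphismProperty.HasSmallObjectArgument.{u} I := by
  let e := equivShrink.{u} I.toSet
  let c : Cardinal.{u} := max Cardinal.aleph0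
    (Cardinal.sum fun s : Shrink.{u} I.toSet ↦ Cardinal.mk (Pt (e.symm s).1.left))
  have mk_domain_le {A B : Completed G} (i : A ⟶ B) (hi : I i) : Cardinal.mk (Pt A) ≤ c := by
    have := Cardinal.le_sum (fun s : Shrink.{u} I.toSet ↦ Cardinal.mk (Pt (e.symm s).1.left))
      (e ⟨Arrow.mk i, hi⟩)
    simp only [Equiv.symm_apply_apply] at this
    exact this.trans (le_max_right _ _)
  have pushouts_le : (MorphismProperty.coproducts.{u}
      (MorphismProperty.ofHoms I.homFamily)).pushouts ≤ (embeddingTests G).llp := by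
    rw [I.ofHoms_homFamily]
    exact (MorphismProperty.pushouts_monotone ((MorphismProperty.coproducts_monotone hI).trans
      (MorphismProperty.coproducts_le _))).trans MorphismProperty.pushouts_le
  have : Fact (Order.succ c).IsRegular := ⟨Cardinal.isRegular_succ (le_max_left _ _)⟩
  have : Nonempty (Order.succ c).ord.ToType :=
    IsCardinalFiltered.nonempty _ (Order.succ c)
  let _ : OrderBot (Order.succ c).ord.ToType := WellFoundedLT.toOrderBot (α := _)
  refine ⟨Order.succ c, inferInstance, inferInstance,
    { preservesColimit i hi f hf := ?_ }⟩
  have := hf.isWellOrderContinuous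
  exact preservesColimit_coyoneda (hasCardinalLT_succ (mk_domain_le i hi)) hf.F fun j hj ↦
    pushouts_le _ (hf.transfiniteCompositionOfShape.map_mem j hj)

end Smallness

end IsvtTop

/-! ### Lifting properties and path objects -/

section ExtendPath

open scoped unitInterval

variable {T M : Type*} [TopologicalSpace T] [TopologicalSpace M]

lemma exists_extension_path (p a b : C(T × I, M)) (ha : ∀ x, a (x, 0) = p (x, 0))
    (hb : ∀ x, b (x, 0) = p (x, 1)) :
    ∃ w : C((T × I) × I, M), (∀ x s, w ((x, 0), s) = p (x, s)) ∧
      (∀ x, w (x, 0) = a x) ∧ ∀ x, w (x, 1) = b x := by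
  -- For each `t`, the path runs along the reverse of `a` on `[0, t]`, then `p`, then `b` on
  -- `[0, t]`, linearly parametrized by `τ = s (1 + 2 t) - t ∈ [-t, 1 + t]`.
  let τ : C((T × I) × I, ℝ) := ⟨fun q ↦ q.2 * (1 + 2 * q.1.2) - q.1.2, by fun_prop⟩
  let clamp : C(ℝ, I) := ⟨Set.projIcc 0 1 zero_le_one, continuous_projIcc⟩
  have clamp_coe (t : I) : clamp t = t := Set.projIcc_val zero_le_one t
  let w (q : (T × I) × I) : M := if τ q ≤ 0 then a (q.1.1, clamp (-τ q)) else
    if τ q ≤ 1 then p (q.1.1, clamp (τ q)) else b (q.1.1, clamp (τ q - 1))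
  have hw : Continuous w := by
    refine .if_le (by fun_prop) (.if_le (by fun_prop) (by fun_prop) (by fun_prop) (by fun_prop)
      fun q hq ↦ ?_) (by fun_prop) (by fun_prop) fun q hq ↦ ?_
    · rw [hq, sub_self, show clamp 1 = 1 from clamp_coe 1, show clamp 0 = 0 from clamp_coe 0, hb]
    · rw [hq, if_pos zero_le_one, neg_zero, show clamp 0 = 0 from clamp_coe 0, ha]
  refine ⟨⟨w, hw⟩, fun x s ↦ ?_, fun ⟨x, t⟩ ↦ ?_, fun ⟨x, t⟩ ↦ ?_⟩
  · have hτ : τ ((x, 0), s) = s := by simp [τ]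
    simp only [ContinuousMap.coe_mk, w, hτ]
    split_ifs with h₀ h₁
    · obtain rfl : s = 0 := le_antisymm h₀ s.2.1
      rw [Set.Icc.coe_zero, neg_zero, show clamp 0 = 0 from clamp_coe 0, ha]
    · rw [clamp_coe]
    · exact (h₁ s.2.2).elim
  · have hτ : τ ((x, t), 0) = -t := by simp [τ]
    simp only [ContinuousMap.coe_mk, w, hτ, if_pos (neg_nonpos.2 t.2.1), neg_neg, clamp_coe]
  · have hτ : τ ((x, t), 1) = 1 + t := by simp [τ]; ring
    have ht : ¬ (1 : ℝ) + t ≤ 0 := by linarith [t.2.1]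
    simp only [ContinuousMap.coe_mk, w, hτ, if_neg ht]
    split_ifs with h₁
    · obtain rfl : t = 0 := le_antisymm (by linarith : (t : ℝ) ≤ 0) t.2.1
      rw [Set.Icc.coe_zero, add_zero, show clamp 1 = 1 from clamp_coe 1, hb]
    · rw [add_sub_cancel_left, clamp_coe]

end ExtendPath

namespace IsvtTop

variable {G : Type u} [Group G]

open scoped unitInterval

section Lifting

variable [Finite G]

lemma rlp_ofHoms_linkProd_iff {A B : ℕ → TopCat.{u}} (i : ∀ n, A n ⟶ B n) {X Y : Completed G}
    (f : X ⟶ Y) :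
    (MorphismProperty.ofHoms fun p : LTSeries (Subgroup G) × ℕ ↦ (linkProd p.1).map (i p.2)).rlp f ↔
      ∀ H, (MorphismProperty.ofHoms i).rlp ((linkMap H).map f) := by
  constructor
  · rintro h H _ _ _ ⟨n⟩
    exact ((linkAdjunction H).hasLiftingProperty_iff _ _).1 (h _ ⟨(H, n)⟩)
  · rintro h _ _ _ ⟨p⟩
    exact ((linkAdjunction p.1).hasLiftingProperty_iff _ _).2 (h p.1 _ ⟨p.2⟩)

lemma rlp_generatingAcyclicCofibrations_iff {X Y : Completed G} (f : X ⟶ Y) :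
    (generatingAcyclicCofibrations G).rlp f ↔ ∀ H, serreFibrations ((linkMap H).map f) :=
  rlp_ofHoms_linkProd_iff _ f

lemma rlp_generatingCofibrations_iff {X Y : Completed G} (f : X ⟶ Y) :
    (generatingCofibrations G).rlp f ↔ ∀ H, weakHomotopyEquivalences ((linkMap H).map f) ∧
      serreFibrations ((linkMap H).map f) :=
  (rlp_ofHoms_linkProd_iff _ f).trans (forall_congr' fun _ ↦ rlp_diskBoundaryInclusion_iff)

end Lifting

section PathSpace

variable (X Y : IsvtTop G) (A : TopCat.{u})

/-- The points of the path object of `Y`: the paths along which the isotropy group is constant. -/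
def PathPt : Type u :=
  {p : C(I, Y.carrier) // ∀ (s t : I) (g : G), g • p s = p s → g • p t = p t}

instance : TopologicalSpace (PathPt Y) := inferInstanceAs (TopologicalSpace (Subtype _))

instance : MulAction G (PathPt Y) where
  smul g p := ⟨⟨fun t ↦ g • p.1 t, p.1.continuous.const_smul g⟩, fun s t k hk ↦ by
    have := p.2 s t (g⁻¹ * k * g) (by
      change k • g • p.1 s = g • p.1 s at hk
      rw [mul_smul, mul_smul, hk, inv_smul_smul])
    rwa [mul_smul, mul_smul, inv_smul_eq_iff] at this⟩
  one_smul p := Subtype.ext (ContinuousMap.ext fun t ↦ one_smul G (p.1 t))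
  mul_smul g k p := Subtype.ext (ContinuousMap.ext fun t ↦ mul_smul g k (p.1 t))

instance : ContinuousConstSMul G (PathPt Y) where
  continuous_const_smul g :=
    Continuous.subtype_mk ((ContinuousMap.continuous_postcomp
      (⟨fun y ↦ g • y, continuous_const_smul g⟩ : C(Y.carrier, Y.carrier))).comp
        continuous_subtype_val) _

/-- The path object of `Y` in the category of `G`-spaces and isovariant maps. -/
def pathSpace : IsvtTop G where
  carrier := PathPt Y

variable {Y}

lemma PathPt.smul_eq_iff (p : PathPt Y) (t : I) (g : G) : g • p = p ↔ g • p.1 t = p.1 t :=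
  ⟨fun h ↦ congrArg (fun q : PathPt Y ↦ q.1 t) h, fun h ↦
    Subtype.ext (ContinuousMap.ext fun s ↦ p.2 t s g h)⟩

lemma PathPt.continuous_eval : Continuous fun q : PathPt Y × I ↦ q.1.1 q.2 := by
  have : Continuous fun q : PathPt Y × I ↦ q.1.1 := continuous_subtype_val.comp continuous_fst
  fun_prop

variable (Y)

/-- The evaluation of paths at `t`. -/
def pathEval (t : I) : pathSpace Y ⟶ Y :=
  ⟨⟨fun p : PathPt Y ↦ p.1 t, (continuous_eval_const t).comp continuous_subtype_val⟩,
    .of_smul_eq (fun _ _ ↦ rfl) fun g (p : PathPt Y) hp ↦ (p.smul_eq_iff t g).2 hp⟩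

/-- The map sending a point to the constant path at this point. -/
def constPath : Y ⟶ pathSpace Y :=
  ⟨⟨fun y ↦ (⟨.const I y, fun _ _ _ h ↦ h⟩ : PathPt Y),
    ContinuousMap.const'.continuous.subtype_mk _⟩,
    .of_smul_eq (fun _ _ ↦ rfl) fun _ _ h ↦ congrArg (fun q : PathPt Y ↦ q.1 0) h⟩

/-- The map from the path object to the product sending a path to its endpoints. The product is
taken in the completed category: its points are pairs of points with the same isotropy group. -/
noncomputable def endpoints :
    (WithTerminal.incl.obj (pathSpace Y) : Completed G) ⟶
      WithTerminal.incl.obj Y ⨯ WithTerminal.incl.obj Y :=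
  prod.lift (WithTerminal.incl.map (pathEval Y 0)) (WithTerminal.incl.map (pathEval Y 1))

lemma endpoints_fst : endpoints Y ≫ prod.fst = WithTerminal.incl.map (pathEval Y 0) :=
  prod.lift_fst _ _

lemma endpoints_snd : endpoints Y ≫ prod.snd = WithTerminal.incl.map (pathEval Y 1) :=
  prod.lift_snd _ _

variable {Y}

/-- The exponential law: homotopies `X × A × I → Y` through isovariant maps are the same as
isovariant maps from `X × A` to the path object of `Y`. -/
def pathEquiv : (X.prodTop (.of (A × I)) ⟶ Y) ≃ (X.prodTop A ⟶ pathSpace Y) where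
  toFun f := ⟨⟨fun p : X.carrier × A ↦ (⟨⟨fun t ↦ f.1 (p.1, (p.2, t)),
        (map_continuous f.1).comp (by fun_prop : Continuous fun t : I ↦ (p.1, (p.2, t)))⟩,
      fun s t g h ↦ (f.2.smul_eq_iff g (p.1, (p.2, t))).2 (Prod.ext
        (congrArg Prod.fst ((f.2.smul_eq_iff g (p.1, (p.2, s))).1 h) :) rfl)⟩ : PathPt Y),
      (ContinuousMap.curry ⟨fun q : (X.carrier × A) × I ↦ f.1 (q.1.1, (q.1.2, q.2)),
        (map_continuous f.1).comp (by fun_prop :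
          Continuous fun q : (X.carrier × A) × I ↦
            (q.1.1, (q.1.2, q.2)))⟩).continuous.subtype_mk _⟩,
    .of_smul_eq (fun g p ↦ Subtype.ext (ContinuousMap.ext fun t ↦ f.2.1 g (p.1, (p.2, t))))
      fun g p h ↦ Prod.ext (congrArg Prod.fst ((f.2.smul_eq_iff g (p.1, (p.2, 0))).1
        (congrArg (fun q : PathPt Y ↦ q.1 0) h)) :) rfl⟩
  invFun φ := ⟨⟨fun p : X.carrier × (A × I) ↦ (φ.1 (p.1, p.2.1) : PathPt Y).1 p.2.2,
      PathPt.continuous_eval.comp (((map_continuous φ.1).comp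
        (by fun_prop : Continuous fun p : X.carrier × (A × I) ↦ (p.1, p.2.1))).prodMk
          (by fun_prop))⟩,
    .of_smul_eq (fun g p ↦ congrArg (fun q : PathPt Y ↦ q.1 p.2.2) (φ.2.1 g (p.1, p.2.1)))
      fun g p h ↦ Prod.ext (congrArg Prod.fst ((φ.2.smul_eq_iff g (p.1, p.2.1)).1
        ((PathPt.smul_eq_iff (φ.1 (p.1, p.2.1) : PathPt Y) p.2.2 g).2 h)) :) rfl⟩
  left_inv _ := rfl
  right_inv _ := rfl

/-- The inclusion of the base of the cylinder on `A`. -/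
def cylinderZero : A ⟶ TopCat.of (A × I) :=
  TopCat.ofHom ⟨fun a ↦ (a, 0), by fun_prop⟩

variable {X A}

lemma exists_lift_pathSpace [LocallyCompactSpace X.carrier]
    (p : X.prodFunctor.obj A ⟶ pathSpace Y) (a b : X.prodFunctor.obj (.of (A × I)) ⟶ Y)
    (ha : X.prodFunctor.map (cylinderZero A) ≫ a = p ≫ pathEval Y 0)
    (hb : X.prodFunctor.map (cylinderZero A) ≫ b = p ≫ pathEval Y 1) :
    ∃ w : X.prodFunctor.obj (.of (A × I)) ⟶ pathSpace Y,
      X.prodFunctor.map (cylinderZero A) ≫ w = p ∧ w ≫ pathEval Y 0 = a ∧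
        w ≫ pathEval Y 1 = b := by
  let p' := prodHomEquiv X _ Y ((pathEquiv X A).symm p)
  let a' := prodHomEquiv X _ Y a
  let b' := prodHomEquiv X _ Y b
  have ha' (x : A) : a' (x, 0) = p' (x, 0) :=
    congrArg (fun f : X.prodTop A ⟶ Y ↦ prodHomEquiv X A Y f x) ha
  have hb' (x : A) : b' (x, 0) = p' (x, 1) :=
    congrArg (fun f : X.prodTop A ⟶ Y ↦ prodHomEquiv X A Y f x) hb
  obtain ⟨w, hwp, hwa, hwb⟩ := exists_extension_path p'.hom a'.hom b'.hom ha' hb'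
  refine ⟨pathEquiv X (.of (A × I)) ((prodHomEquiv X (.of ((A × I) × I)) Y).symm (TopCat.ofHom w)),
    hom_ext fun q ↦ Subtype.ext (ContinuousMap.ext fun s ↦ ?_), hom_ext fun q ↦ ?_,
    hom_ext fun q ↦ ?_⟩
  · exact congrArg (fun f ↦ f.1 q.1) (hwp q.2 s)
  · exact congrArg (fun f ↦ f.1 q.1) (hwa q.2)
  · exact congrArg (fun f ↦ f.1 q.1) (hwb q.2)

lemma exists_iso_comp_cylinderZero_eq (n : ℕ) :
    ∃ e : TopCat.of (TopCat.disk.{u} n × ({0} : Set I)) ≅ TopCat.disk.{u} n,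
      e.hom ≫ cylinderZero _ = diskCylinderInclusion n := by
  refine ⟨TopCat.isoOfHomeo (Homeomorph.prodUnique _ _), TopCat.hom_ext (ContinuousMap.ext ?_)⟩
  rintro ⟨x, ⟨_, rfl⟩⟩
  rfl

lemma generatingAcyclicCofibrations_rlp_of_cylinderZero {Z W : Completed G} {f : Z ⟶ W}
    (hf : ∀ (H : LTSeries (Subgroup G)) (n : ℕ),
      HasLiftingProperty ((linkProd H).map (cylinderZero (TopCat.disk.{u} n))) f) :
    (generatingAcyclicCofibrations G).rlp f := by
  rintro _ _ _ ⟨H, n⟩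
  obtain ⟨e, he⟩ := exists_iso_comp_cylinderZero_eq.{u} n
  have := hf H n
  rw [← he, Functor.map_comp]
  infer_instance

variable (Y) in
lemma generatingAcyclicCofibrations_rlp_endpoints [Finite G] :
    (generatingAcyclicCofibrations G).rlp (endpoints Y) :=
  generatingAcyclicCofibrations_rlp_of_cylinderZero fun H n ↦
    { sq_hasLift {p q} sq := by
        have hfst : (linkProd H).map (cylinderZero _) ≫ q ≫ prod.fst =
            p ≫ WithTerminal.incl.map (pathEval Y 0) := by
          rw [← endpoints_fst, ← Category.assoc, ← sq.w, Category.assoc]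
        have hsnd : (linkProd H).map (cylinderZero _) ≫ q ≫ prod.snd =
            p ≫ WithTerminal.incl.map (pathEval Y 1) := by
          rw [← endpoints_snd, ← Category.assoc, ← sq.w, Category.assoc]
        obtain ⟨w, hwp, hwa, hwb⟩ := exists_lift_pathSpace (X := linkingSimplex H)
          (WithTerminal.down p) (WithTerminal.down (q ≫ prod.fst))
          (WithTerminal.down (q ≫ prod.snd)) hfst hsnd
        refine ⟨⟨⟨WithTerminal.incl.map w, hwp, Limits.prod.hom_ext ?_ ?_⟩⟩⟩
        · exact (Category.assoc _ _ _).trans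
            ((congrArg (WithTerminal.incl.map w ≫ ·) (endpoints_fst Y)).trans hwa)
        · exact (Category.assoc _ _ _).trans
            ((congrArg (WithTerminal.incl.map w ≫ ·) (endpoints_snd Y)).trans hwb) }

lemma generatingAcyclicCofibrations_rlp_to_star {Z : Completed G} (f : Z ⟶ .star) :
    (generatingAcyclicCofibrations G).rlp f :=
  generatingAcyclicCofibrations_rlp_of_cylinderZero fun H n ↦
    { sq_hasLift {p q} sq :=
        ⟨⟨⟨(linkProd H).map (TopCat.ofHom ⟨Prod.fst, continuous_fst⟩) ≫ p, by
          rw [← Functor.map_comp_assoc]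
          exact (congrArg (· ≫ p) ((linkProd H).map_id _)).trans (Category.id_comp p),
          WithTerminal.starTerminal.hom_ext _ _⟩⟩⟩ }

end PathSpace

section AcyclicCofibrations

lemma weakHomotopyEquivalences_mapIsvt (X : IsvtTop G) [LocallyCompactSpace X.carrier]
    {A B : IsvtTop G} {i : A ⟶ B} {r : B ⟶ A} (hir : i ≫ r = 𝟙 A) {k : B ⟶ pathSpace B}
    (hik : i ≫ k = i ≫ constPath B) (hk₀ : k ≫ pathEval B 0 = 𝟙 B)
    (hk₁ : k ≫ pathEval B 1 = r ≫ i) : weakHomotopyEquivalences (X.mapIsvt.map i) := by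
  let M := X.mapIsvt.obj B
  let h : TopCat.of (M × I) ⟶ M :=
    prodHomEquiv X _ B ((pathEquiv X M).symm ((prodHomEquiv X M B).symm (𝟙 M) ≫ k))
  refine weakHomotopyEquivalences_of_deformationRetraction (X.mapIsvt.map i) (X.mapIsvt.map r)
    ?_ h.hom ?_ ?_ ?_
  · rw [← Functor.map_comp, hir, CategoryTheory.Functor.map_id]
  · exact fun φ ↦ congrArg (fun f ↦ X.mapIsvt.map f φ) hk₀
  · exact fun φ ↦ congrArg (fun f ↦ X.mapIsvt.map f φ) hk₁
  · exact fun φ t ↦ congrArg (fun f ↦ X.mapIsvt.map (f ≫ pathEval B t) φ) hik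

variable {A B : Completed G} {i : A ⟶ B}

lemma exists_retraction_of_llp_rlp (hi : (generatingAcyclicCofibrations G).rlp.llp i) :
    ∃ r : B ⟶ A, i ≫ r = 𝟙 A := by
  have := hi _ (generatingAcyclicCofibrations_rlp_to_star (WithTerminal.starTerminal.from A))
  have sq : CommSq (𝟙 A) i (WithTerminal.starTerminal.from A)
    (WithTerminal.starTerminal.from B) := ⟨WithTerminal.starTerminal.hom_ext _ _⟩
  exact ⟨sq.lift, sq.fac_left⟩

lemma exists_homotopy_of_llp_rlp [Finite G] {A B : IsvtTop G} {i : A ⟶ B} {r : B ⟶ A}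
    (hi : (generatingAcyclicCofibrations G).rlp.llp (WithTerminal.incl.map i)) (hir : i ≫ r = 𝟙 A) :
    ∃ k : B ⟶ pathSpace B, i ≫ k = i ≫ constPath B ∧ k ≫ pathEval B 0 = 𝟙 B ∧
      k ≫ pathEval B 1 = r ≫ i := by
  have := hi _ (generatingAcyclicCofibrations_rlp_endpoints B)
  have sq : CommSq (WithTerminal.incl.map (i ≫ constPath B)) (WithTerminal.incl.map i)
      (endpoints B) (prod.lift (𝟙 _) (WithTerminal.incl.map (r ≫ i))) := by
    refine ⟨Limits.prod.hom_ext ?_ ?_⟩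
    · rw [Category.assoc, endpoints_fst, Category.assoc, prod.lift_fst, Category.comp_id]
      rfl
    · rw [Category.assoc, endpoints_snd, Category.assoc, prod.lift_snd, ← Functor.map_comp,
        ← Functor.map_comp, ← Category.assoc i r i, hir, Category.id_comp]
      rfl
  have hk := sq.fac_right
  refine ⟨WithTerminal.down sq.lift, sq.fac_left, ?_, ?_⟩
  · have := hk =≫ prod.fst
    rwa [Category.assoc, endpoints_fst, prod.lift_fst] at this
  · have := hk =≫ prod.snd
    rwa [Category.assoc, endpoints_snd, prod.lift_snd] at this

lemma weakHomotopyEquivalences_linkMap_of_llp_rlp [Finite G]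
    (hi : (generatingAcyclicCofibrations G).rlp.llp i) (H : LTSeries (Subgroup G)) :
    weakHomotopyEquivalences ((linkMap H).map i) := by
  obtain ⟨r, hr⟩ := exists_retraction_of_llp_rlp hi
  rcases A with A | _ <;> rcases B with B | _
  · obtain ⟨k, hik, hk₀, hk₁⟩ := exists_homotopy_of_llp_rlp hi hr
    exact weakHomotopyEquivalences_mapIsvt (linkingSimplex H) hr hik hk₀ hk₁
  · exact (WithTerminal.false_of_from_star r).elim
  · exact (WithTerminal.false_of_from_star i).elim
  · have : IsIso i := ⟨r, hr, WithTerminal.starTerminal.hom_ext _ _⟩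
    exact weakHomotopyEquivalences_of_isIso _

end AcyclicCofibrations

end IsvtTop

/-! ### The model structure -/

section Recognition

variable {C : Type v} [Category.{u} C] (W I J : MorphismProperty C)

lemma isWeakFactorizationSystem_llp_rlp [MorphismProperty.HasFactorization I.rlp.llp I.rlp] :
    MorphismProperty.IsWeakFactorizationSystem I.rlp.llp I.rlp where
  rlp := I.rlp_llp_rlp
  llp := rfl

variable {W I J}

-- The retract argument: factor `i` through `J.rlp.llp` and `J.rlp`; by two-out-of-three, the second
-- map is in `W`, hence in `I.rlp`, so `i` lifts against it.
lemma llp_rlp_inf_eq_of_rlp_eq_inf [W.HasTwoOutOfThreeProperty]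
    [MorphismProperty.HasFactorization J.rlp.llp J.rlp] (hIJ : I.rlp = J.rlp ⊓ W)
    (hJ : J.rlp.llp ≤ W) : I.rlp.llp ⊓ W = J.rlp.llp := by
  refine le_antisymm (fun A B i hi ↦ ?_)
    (le_inf (MorphismProperty.antitone_llp (hIJ.le.trans inf_le_left)) hJ)
  have d := MorphismProperty.factorizationData J.rlp.llp J.rlp i
  have hp : I.rlp d.p := by
    rw [hIJ]
    refine ⟨d.hp, W.of_precomp d.i d.p (hJ _ d.hi) ?_⟩
    rw [d.fac]
    exact hi.2
  have := hi.1 _ hp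
  exact MorphismProperty.of_retract (RetractArrow.ofLeftLiftingProperty d.fac) d.hi

variable [HasLimits C] [HasColimits C] [W.HasTwoOutOfThreeProperty]
  [MorphismProperty.IsSmall.{u} I] [MorphismProperty.IsSmall.{u} J]
  [MorphismProperty.HasSmallObjectArgument.{u} I] [MorphismProperty.HasSmallObjectArgument.{u} J]

/-- The recognition theorem for cofibrantly generated model categories: the model structure with
weak equivalences `W`, cofibrations `I.rlp.llp` and fibrations `J.rlp`. -/
noncomputable abbrev modelCategoryOfRlp (hIJ : I.rlp = J.rlp ⊓ W) (hJ : J.rlp.llp ≤ W) :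
    ModelCategory C :=
  letI : CategoryWithWeakEquivalences C := ⟨W⟩
  letI : CategoryWithCofibrations C := ⟨I.rlp.llp⟩
  letI : CategoryWithFibrations C := ⟨J.rlp⟩
  have : (weakEquivalences C).HasTwoOutOfThreeProperty :=
    inferInstanceAs W.HasTwoOutOfThreeProperty
  have : MorphismProperty.IsWeakFactorizationSystem (cofibrations C) (trivialFibrations C) := by
    rw [show trivialFibrations C = I.rlp from hIJ.symm]
    exact isWeakFactorizationSystem_llp_rlp I
  have : MorphismProperty.IsWeakFactorizationSystem (trivialCofibrations C) (fibrations C) := by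
    rw [show trivialCofibrations C = J.rlp.llp from llp_rlp_inf_eq_of_rlp_eq_inf hIJ hJ]
    exact isWeakFactorizationSystem_llp_rlp J
  ModelCategory.mk' C

lemma isCofibrantlyGeneratedBy_modelCategoryOfRlp (hIJ : I.rlp = J.rlp ⊓ W) (hJ : J.rlp.llp ≤ W)
    (domains_I : ∀ {A B : C} (i : A ⟶ B), I i → IsSmallRelativeTo A (relativeCells I))
    (domains_J : ∀ {A B : C} (j : A ⟶ B), J j → IsSmallRelativeTo A (relativeCells J)) :
    letI := modelCategoryOfRlp hIJ hJ
    IsCofibrantlyGeneratedBy I J :=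
  letI := modelCategoryOfRlp hIJ hJ
  { hasLimits := inferInstance
    hasColimits := inferInstance
    factorization_cof := by
      rw [show trivialFibrations C = I.rlp from hIJ.symm]
      exact inferInstanceAs (MorphismProperty.HasFunctorialFactorization I.rlp.llp I.rlp)
    factorization_fib := by
      rw [show trivialCofibrations C = J.rlp.llp from llp_rlp_inf_eq_of_rlp_eq_inf hIJ hJ]
      exact inferInstanceAs (MorphismProperty.HasFunctorialFactorization J.rlp.llp J.rlp)
    isSmall_I := inferInstance
    isSmall_J := inferInstance
    domains_I := domains_I
    domains_J := domains_J
    trivialFibrations_eq := hIJ.symm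
    fibrations_eq := rfl }

end Recognition

namespace IsvtTop

section ModelStructure

variable (G : Type u) [Group G]

/-- The weak equivalences of the isovariant model structure. -/
def isovariantEquivalences : MorphismProperty (Completed G) :=
  fun _ _ f ↦ ∀ H, weakHomotopyEquivalences ((linkMap H).map f)

instance : (isovariantEquivalences G).HasTwoOutOfThreeProperty where
  comp_mem f g hf hg H := by
    rw [CategoryTheory.Functor.map_comp]
    exact weakHomotopyEquivalences.comp_mem _ _ (hf H) (hg H)
  of_postcomp f g hg hfg H := weakHomotopyEquivalences.of_postcomp _ _ (hg H) (by
    rw [← CategoryTheory.Functor.map_comp]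
    exact hfg H)
  of_precomp f g hf hfg H := weakHomotopyEquivalences.of_precomp _ _ (hf H) (by
    rw [← CategoryTheory.Functor.map_comp]
    exact hfg H)

instance : MorphismProperty.IsSmall.{u} (generatingCofibrations G) := by
  unfold generatingCofibrations
  infer_instance

instance : MorphismProperty.IsSmall.{u} (generatingAcyclicCofibrations G) := by
  unfold generatingAcyclicCofibrations
  infer_instance

instance : MorphismProperty.HasSmallObjectArgument.{u} (generatingCofibrations G) :=
  hasSmallObjectArgument_of_le_llp_embeddingTests generatingCofibrations_le_llp_embeddingTests

instance : MorphismProperty.HasSmallObjectArgument.{u} (generatingAcyclicCofibrations G) :=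
  hasSmallObjectArgument_of_le_llp_embeddingTests
    generatingAcyclicCofibrations_le_llp_embeddingTests

variable [Finite G]

lemma rlp_generatingCofibrations_eq_inf : (generatingCofibrations G).rlp =
    (generatingAcyclicCofibrations G).rlp ⊓ isovariantEquivalences G := by
  ext X Y f
  rw [rlp_generatingCofibrations_iff, forall_and, ← rlp_generatingAcyclicCofibrations_iff]
  exact and_comm

lemma llp_rlp_generatingAcyclicCofibrations_le :
    (generatingAcyclicCofibrations G).rlp.llp ≤ isovariantEquivalences G :=
  fun _ _ _ hi H ↦ weakHomotopyEquivalences_linkMap_of_llp_rlp hi H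

/-- The isovariant model structure on the completed category of `G`-spaces and isovariant maps. -/
noncomputable abbrev modelCategory : ModelCategory (Completed G) :=
  modelCategoryOfRlp (rlp_generatingCofibrations_eq_inf G)
    (llp_rlp_generatingAcyclicCofibrations_le G)

lemma isCofibrantlyGeneratedBy_modelCategory :
    letI := modelCategory G
    IsCofibrantlyGeneratedBy (generatingCofibrations G) (generatingAcyclicCofibrations G) :=
  isCofibrantlyGeneratedBy_modelCategoryOfRlp _ _
    (fun _ _ ↦
      isSmallRelativeTo_relativeCells generatingCofibrations_le_llp_embeddingTests _)
    fun _ _ ↦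
      isSmallRelativeTo_relativeCells generatingAcyclicCofibrations_le_llp_embeddingTests _

end ModelStructure

end IsvtTop

theorem mainTheorem2 (G : Type u) [Group G] [Finite G] :
    (∀ H : LTSeries (Subgroup G),
      Nonempty (IsvtTop.linkProd H ⊣ (IsvtTop.linkMap H : IsvtTop.Completed G ⥤ TopCat.{u}))) ∧
    ∃ _ : ModelCategory (IsvtTop.Completed G),
      IsCofibrantlyGeneratedBy (IsvtTop.generatingCofibrations G)
        (IsvtTop.generatingAcyclicCofibrations G) ∧
      (∀ ⦃X Y : IsvtTop.Completed G⦄ (f : X ⟶ Y), WeakEquivalence f ↔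
        ∀ H : LTSeries (Subgroup G), weakHomotopyEquivalences ((IsvtTop.linkMap H).map f)) ∧
      (∀ ⦃X Y : IsvtTop.Completed G⦄ (f : X ⟶ Y), Fibration f ↔
        ∀ H : LTSeries (Subgroup G), serreFibrations ((IsvtTop.linkMap H).map f)) :=
  letI := IsvtTop.modelCategory G
  ⟨fun H ↦ ⟨IsvtTop.linkAdjunction H⟩, this, IsvtTop.isCofibrantlyGeneratedBy_modelCategory G,
    fun _ _ f ↦ weakEquivalence_iff f,
    fun _ _ f ↦ (fibration_iff f).trans (IsvtTop.rlp_generatingAcyclicCofibrations_iff f)⟩
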